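/- Let $d\ge 0$ be an integer, $\tau\in(0,1)$, $s\ge 0$, and let $v_s(z)=(1+|z|^2)^{s/2}$ on $\mathbb R^{2d}$. Write $\pi(x,\omega)g(t)=e^{2\pi i\omega\cdot t}g(t-x)$ and $V_gf(x,\omega)=\langle f,\pi(x,\omega)g\rangle$, where $\langle\cdot,\cdot\rangle$ is the pairing of $\mathcal S'$ and $\mathcal S$ that is conjugate-linear in the second argument. For a symbol $\sigma\in\mathcal S'(\mathbb R^{2d})$ let $\mathrm{Op}_\tau(\sigma):\mathcal S(\mathbb R^d)\to\mathcal S'(\mathbb R^d)$ be defined by $$\langle \mathrm{Op}_\tau(\sigma)f,g\rangle=\langle\sigma,W_\tau(g,f)\rangle,\qquad W_\tau(g,f)(x,\omega)=\int_{\mathbb R^d}e^{-2\pi i y\cdot\omega}\,g(x+\tau y)\,\overline{f(x-(1-\tau)y)}\,dy .$$ Suppose that $\sigma\in W(\mathcal FL^\infty,L^1_{v_s})(\mathbb R^{2d})$, that is, for some non-zero window $\Phi\in\mathcal S(\mathbb R^{2d})$, $$\int_{\mathbb R^{2d}}\ \operatorname*{ess\,sup}_{y\in\mathbb R^{2d}}|V_\Phi\sigma(x,y)|\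 v_s(x)\,dx<\infty .$$ (i) Let $\mathcal U_\tau=-\begin{pmatrix}\frac{\tau}{1-\tau}I_d&0\\0&\frac{1-\tau}{\tau}I_d\end{pmatrix}\in \mathrm{Sp}(2d,\mathbb R)$. Then $\mathrm{Op}_\tau(\sigma)\in FIO(\mathcal U_\tau,v_s)$: for every $g\in\mathcal S(\mathbb R^d)$ there is a function $H$ with $\int_{\mathbb R^{2d}}|H|\,v_s<\infty$ such that $$|\langle \mathrm{Op}_\tau(\sigma)\pi(z)g,\pi(w)g\rangle|\le H(w-\mathcal U_\tau z)\qquad\text{for all } w,z\in\mathbb R^{2d}.$$ (ii) $\mathrm{Op}_\tau(\sigma)$ is bounded on every modulation space $M^p_{v_s}(\mathbb R^d)=\{f\in\mathcal S'(\mathbb R^d): V_\varphi f\cdot v_s\in L^p(\mathbb R^{2d})\}$, $1\le p\le\infty$, normed by $\|V_\varphi f\cdot v_s\|_{L^p}$ for any non-zero window $\varphi\in\mathcal S(\mathbb R^d)$. That is, $\mathcal S(\mathbb R^d)\subset M^p_{v_s}(\mathbb R^d)$, and $\mathrm{Op}_\tau(\sigma)$ extends to a bounded linear operator $T$ from $M^p_{v_s}(\mathbb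 R^d)$ to itself, such that $Tf_n\to Tf$ weakly in $\mathcal S'$ whenever $(f_n)$ is norm-bounded in $M^p_{v_s}(\mathbb R^d)$ and $f_n\to f\in M^p_{v_s}(\mathbb R^d)$ weakly in $\mathcal S'$. -/

import Mathlib

open MeasureTheory SchwartzMap FourierTransform
open scoped ENNReal NNReal

noncomputable section
namespace TimeFrequency

section PartialFourier
set_option linter.unusedSectionVars false
variable {E V : Type} [NormedAddCommGroup E] [InnerProductSpace ℝ E] [FiniteDimensional ℝ E]
  [MeasurableSpace E] [BorelSpace E] [NormedAddCommGroup V] [NormedSpace ℂ V]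

def slice (F : 𝓢(E × E, V)) (x : E) : 𝓢(E, V) :=
  compCLM ℝ (g := fun y : E => (x, y))
    (by
      have h := (Function.HasTemperateGrowth.const (E := E) ((x, 0) : E × E)).add
        (ContinuousLinearMap.inr ℝ E E).hasTemperateGrowth
      convert h using 1
      ext y <;> simp)
    ⟨1, 1, fun y => by
      have := le_max_right ‖x‖ ‖y‖
      simp only [Prod.norm_mk]; linarith⟩ F

theorem slice_apply (F : 𝓢(E × E, V)) (x y : E) : slice F x y = F (x, y) := rfl

/-- The partial Fourier transform in the second variable. -/
def partialFourierFun (F : 𝓢(E × E, V)) (z : E × E) : V := 𝓕 (fun y => F (z.1, y)) z.2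

/-- The integrand of the partial Fourier transform. -/
def ftIntegrand (F : 𝓢(E × E, V)) (z : E × E) (y : E) : V :=
  Real.fourierChar (-inner ℝ y z.2) • F (z.1, y)

theorem partialFourierFun_eq (F : 𝓢(E × E, V)) (z : E × E) :
    partialFourierFun F z = ∫ y, ftIntegrand F z y :=
  Real.fourier_eq _ _

def dSnd : 𝓢(E × E, V) →L[ℝ] 𝓢(E × E, E →L[ℝ] V) :=
  (postcompCLM ((ContinuousLinearMap.compL ℝ E (E × E) V).flip
    (ContinuousLinearMap.inr ℝ E E))) ∘L fderivCLM ℝ (E × E) V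

def dTot : 𝓢(E × E, V) →L[ℝ] 𝓢(E × E, (E × E) →L[ℝ] V) :=
  (postcompCLM ((ContinuousLinearMap.compL ℝ (E × E) (E × E) V).flip
    ((ContinuousLinearMap.inl ℝ E E) ∘L (ContinuousLinearMap.fst ℝ E E)))) ∘L
      fderivCLM ℝ (E × E) V
  - (postcompCLM (((2 * Real.pi * Complex.I : ℂ) • ContinuousLinearMap.id ℂ
      ((E × E) →L[ℝ] V)).restrictScalars ℝ)) ∘L
    smulRightCLM ℝ V ((ContinuousLinearMap.compL ℝ (E × E) E ℝ).flip
      (ContinuousLinearMap.snd ℝ E E) ∘L (innerSL ℝ) ∘L (ContinuousLinearMap.snd ℝ E E))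

theorem seminorm_comp_bound {D D' W W' : Type} [NormedAddCommGroup D] [NormedSpace ℝ D]
    [NormedAddCommGroup D'] [NormedSpace ℝ D'] [NormedAddCommGroup W] [NormedSpace ℝ W]
    [NormedAddCommGroup W'] [NormedSpace ℝ W'] (T : 𝓢(D, W) →L[ℝ] 𝓢(D', W'))
    (s : Finset (ℕ × ℕ)) : ∃ (s' : Finset (ℕ × ℕ)) (C : ℝ), 0 ≤ C ∧ ∀ F : 𝓢(D, W),
      s.sup (schwartzSeminormFamily ℝ D' W') (T F) ≤
        C * s'.sup (schwartzSeminormFamily ℝ D W) F := by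
  have hc : Continuous ((s.sup (schwartzSeminormFamily ℝ D' W')).comp T.toLinearMap) := by
    have := Seminorm.continuous_finsetSup (s := s) (p := schwartzSeminormFamily ℝ D' W')
      (fun i _ => (schwartz_withSeminorms ℝ D' W').continuous_seminorm i)
    exact this.comp T.continuous
  obtain ⟨s', C, -, h⟩ := Seminorm.bound_of_continuous (schwartz_withSeminorms ℝ D W) _ hc
  exact ⟨s', C, C.2, fun F => h F⟩

/-- Uniform decay in the second variable. -/
theorem decay_snd (F : 𝓢(E × E, V)) (a m : ℕ) (x y : E) :
    ‖x‖ ^ a * ‖F (x, y)‖ ≤ (1 + ‖y‖) ^ (-(m : ℝ)) *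
      (2 ^ (a + m) * (Finset.Iic (a + m, 0)).sup (schwartzSeminormFamily ℝ (E × E) V) F) := by
  have h := one_add_le_sup_seminorm_apply (𝕜 := ℝ) (m := (a + m, 0)) le_rfl le_rfl F (x, y)
  rw [norm_iteratedFDeriv_zero] at h
  rw [Real.rpow_neg (by positivity), Real.rpow_natCast, inv_mul_eq_div, le_div_iff₀ (by positivity)]
  refine le_trans ?_ h
  have hx : ‖x‖ ≤ 1 + ‖(x, y)‖ := by
    have := le_max_left ‖x‖ ‖y‖
    simp only [Prod.norm_mk]; linarith
  have hy : 1 + ‖y‖ ≤ 1 + ‖(x, y)‖ := by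
    have := le_max_right ‖x‖ ‖y‖
    simp only [Prod.norm_mk]; linarith
  calc ‖x‖ ^ a * ‖F (x, y)‖ * (1 + ‖y‖) ^ m = (‖x‖ ^ a * (1 + ‖y‖) ^ m) * ‖F (x, y)‖ := by ring
    _ ≤ ((1 + ‖(x, y)‖) ^ a * (1 + ‖(x, y)‖) ^ m) * ‖F (x, y)‖ := by gcongr
    _ = _ := by rw [pow_add]

theorem hasFDerivAt_slice (F : 𝓢(E × E, V)) (x y : E) :
    HasFDerivAt (slice F x) (dSnd F (x, y)) y :=
  (F.hasFDerivAt (x, y)).comp y ((hasFDerivAt_prodMk_right (𝕜 := ℝ) x y))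

theorem norm_mul_partialFourierFun_le (F : 𝓢(E × E, V)) (z : E × E) :
    ‖z.2‖ * ‖partialFourierFun F z‖ ≤ ‖partialFourierFun (dSnd F) z‖ := by
  have hd : fderiv ℝ (slice F z.1) = slice (dSnd F) z.1 :=
    funext fun y => (hasFDerivAt_slice F z.1 y).fderiv
  have h := Real.fourier_fderiv (slice F z.1).integrable (slice F z.1).differentiable
    (by rw [hd]; exact (slice (dSnd F) z.1).integrable)
  rw [hd] at h
  have h2 : partialFourierFun (dSnd F) z =
    VectorFourier.fourierSMulRight (-innerSL ℝ) (𝓕 (slice F z.1 : E → V)) z.2 := congrFun h z.2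
  have h3 := (partialFourierFun (dSnd F) z).le_opNorm z.2
  have h4 : partialFourierFun (dSnd F) z z.2 =
      (-(2 * Real.pi * Complex.I)) • (-(inner ℝ z.2 z.2 : ℝ)) • partialFourierFun F z := by
    rw [h2]
    simp only [VectorFourier.fourierSMulRight_apply, neg_apply]
    rfl
  rw [h4, norm_smul, norm_smul] at h3
  simp only [norm_neg, norm_mul, Complex.norm_I, Complex.norm_real, Complex.norm_ofNat,
    mul_one, real_inner_self_eq_norm_sq, norm_pow, Real.norm_eq_abs, abs_norm,
    abs_of_pos Real.pi_pos] at h3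
  rcases (norm_nonneg z.2).eq_or_lt with h0 | h0
  · rw [← h0]; simp
  · have : (2 * Real.pi * (‖z.2‖ * ‖partialFourierFun F z‖)) * ‖z.2‖ ≤
      ‖partialFourierFun (dSnd F) z‖ * ‖z.2‖ := by
      refine le_trans (le_of_eq ?_) h3; ring
    have := le_of_mul_le_mul_right this h0
    have hp : (1 : ℝ) ≤ 2 * Real.pi := by linarith [Real.pi_gt_three]
    nlinarith [mul_nonneg (norm_nonneg z.2) (norm_nonneg (partialFourierFun F z))]

theorem partialFourierFun_bound_aux (a b : ℕ) : ∀ (V : Type) [NormedAddCommGroup V]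
    [NormedSpace ℂ V], ∃ (s : Finset (ℕ × ℕ)) (C : ℝ), 0 ≤ C ∧ ∀ (F : 𝓢(E × E, V)) (z : E × E),
      ‖z.1‖ ^ a * ‖z.2‖ ^ b * ‖partialFourierFun F z‖ ≤
        C * s.sup (schwartzSeminormFamily ℝ (E × E) V) F := by
  induction b with
  | zero =>
    intro V _ _
    set m := (volume : Measure E).integrablePower
    have hm := Measure.integrable_pow_neg_integrablePower (volume : Measure E)
    refine ⟨Finset.Iic (a + m, 0), (∫ y : E, (1 + ‖y‖) ^ (-(m : ℝ))) * 2 ^ (a + m),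
      mul_nonneg (integral_nonneg fun y => by positivity) (by positivity), fun F z => ?_⟩
    rw [pow_zero, mul_one, partialFourierFun_eq, ← Real.norm_of_nonneg (r := ‖z.1‖ ^ a)
      (by positivity), ← norm_smul, ← integral_smul, mul_assoc, ← integral_mul_const]
    refine norm_integral_le_of_norm_le (hm.mul_const _) (Filter.Eventually.of_forall fun y => ?_)
    rw [norm_smul, Real.norm_of_nonneg (by positivity), ftIntegrand, Circle.norm_smul]
    exact decay_snd F a m z.1 y
  | succ b ih =>
    intro V _ _
    obtain ⟨s, C, hC, h⟩ := ih (E →L[ℝ] V)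
    obtain ⟨s', C', hC', h'⟩ := seminorm_comp_bound (dSnd (E := E) (V := V)) s
    refine ⟨s', C * C', by positivity, fun F z => ?_⟩
    calc ‖z.1‖ ^ a * ‖z.2‖ ^ (b + 1) * ‖partialFourierFun F z‖
        = ‖z.1‖ ^ a * ‖z.2‖ ^ b * (‖z.2‖ * ‖partialFourierFun F z‖) := by ring
      _ ≤ ‖z.1‖ ^ a * ‖z.2‖ ^ b * ‖partialFourierFun (dSnd F) z‖ := by
        gcongr; exact norm_mul_partialFourierFun_le F z
      _ ≤ C * s.sup (schwartzSeminormFamily ℝ (E × E) _) (dSnd F) := h _ _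
      _ ≤ C * (C' * s'.sup (schwartzSeminormFamily ℝ (E × E) V) F) := by
        gcongr; exact h' F
      _ = _ := by ring

theorem dTot_apply (F : 𝓢(E × E, V)) (z v : E × E) :
    dTot F z v = fderiv ℝ F z (v.1, 0) -
      (2 * Real.pi * Complex.I : ℂ) • (inner ℝ z.2 v.2 : ℝ) • F z := rfl

theorem hasFDerivAt_integrand (F : 𝓢(E × E, V)) (y : E) (z : E × E) :
    HasFDerivAt (fun z : E × E => ftIntegrand F z y)
      (ftIntegrand (V := (E × E) →L[ℝ] V) (dTot F) z y) z := by
  have h1 : HasFDerivAt (fun w : E × E => F (w.1, y))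
      ((fderiv ℝ F (z.1, y)) ∘L ((ContinuousLinearMap.inl ℝ E E) ∘L
        (ContinuousLinearMap.fst ℝ E E))) z := by
    have h0 : HasFDerivAt (fun w : E × E => ((w.1, y) : E × E))
      ((ContinuousLinearMap.inl ℝ E E) ∘L (ContinuousLinearMap.fst ℝ E E)) z :=
      (hasFDerivAt_prodMk_left (𝕜 := ℝ) z.1 y).comp z hasFDerivAt_fst
    exact (F.hasFDerivAt (z.1, y)).comp z h0
  have hL : HasFDerivAt (fun w : E × E => -inner ℝ y w.2)
      (-((innerSL ℝ y) ∘L (ContinuousLinearMap.snd ℝ E E))) z :=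
    ((innerSL ℝ y) ∘L (ContinuousLinearMap.snd ℝ E E)).hasFDerivAt.neg
  have h2 : HasFDerivAt (fun w : E × E => ((Real.fourierChar (-inner ℝ y w.2) : Circle) : ℂ)) _ z :=
    HasFDerivAt.comp (g := fun t : ℝ => ((Real.fourierChar t : Circle) : ℂ)) z
      (Real.hasDerivAt_fourierChar (-inner ℝ y z.2)).hasFDerivAt hL
  have h3 := h2.smul h1
  refine h3.congr_fderiv ?_
  refine ContinuousLinearMap.ext fun v => ?_
  have e : (ftIntegrand (V := (E × E) →L[ℝ] V) (dTot F) z y) v =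
    ((Real.fourierChar (-inner ℝ y z.2) : Circle) : ℂ) • (dTot F (z.1, y) v) := rfl
  rw [e, dTot_apply]
  simp only [add_apply, smul_apply, ContinuousLinearMap.smulRight_apply,
    ContinuousLinearMap.comp_apply, ContinuousLinearMap.coe_fst', ContinuousLinearMap.coe_snd',
    ContinuousLinearMap.inl_apply, neg_apply, innerSL_apply_apply,
    ← Complex.coe_smul, smul_sub, smul_smul]
  rw [sub_eq_add_neg, ← neg_smul]
  congr 2
  simp
  ring

theorem exists_integrable_bound (F : 𝓢(E × E, V)) : ∃ b : E → ℝ, Integrable b ∧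
    ∀ (z : E × E) (y : E), ‖ftIntegrand F z y‖ ≤ b y := by
  refine ⟨_, (Measure.integrable_pow_neg_integrablePower (volume : Measure E)).mul_const
    (2 ^ (0 + (volume : Measure E).integrablePower) *
      (Finset.Iic (0 + (volume : Measure E).integrablePower, 0)).sup
        (schwartzSeminormFamily ℝ (E × E) V) F), fun z y => ?_⟩
  rw [ftIntegrand, Circle.norm_smul]
  simpa using decay_snd F 0 (volume : Measure E).integrablePower z.1 y

theorem integrable_integrand (F : 𝓢(E × E, V)) (z : E × E) :
    Integrable (ftIntegrand F z) :=
  (Real.fourierIntegral_convergent_iff (V := E) (f := slice F z.1) (μ := volume) z.2).2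
    (slice F z.1).integrable

theorem hasFDerivAt_partialFourierFun (F : 𝓢(E × E, V)) (z : E × E) :
    HasFDerivAt (partialFourierFun F)
      (partialFourierFun (V := (E × E) →L[ℝ] V) (dTot F) z) z := by
  have e1 : partialFourierFun F = fun z => ∫ y, ftIntegrand F z y :=
    funext (partialFourierFun_eq F)
  have e2 : partialFourierFun (V := (E × E) →L[ℝ] V) (dTot F) z =
    ∫ y, ftIntegrand (V := (E × E) →L[ℝ] V) (dTot F) z y :=
    partialFourierFun_eq (V := (E × E) →L[ℝ] V) (dTot F) z
  obtain ⟨b, hb, hle⟩ := exists_integrable_bound (V := (E × E) →L[ℝ] V) (dTot F)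
  have hm := (integrable_integrand (V := (E × E) →L[ℝ] V) (dTot F) z).aestronglyMeasurable
  rw [e1, e2]
  refine hasFDerivAt_integral_of_dominated_of_fderiv_le (s := Set.univ) (bound := b)
    (F' := fun z y => ftIntegrand (V := (E × E) →L[ℝ] V) (dTot F) z y)
    Filter.univ_mem
    (Filter.Eventually.of_forall fun z => (integrable_integrand F z).aestronglyMeasurable)
    (integrable_integrand F z) hm
    (Filter.Eventually.of_forall fun y z _ => hle z y)
    hb
    (Filter.Eventually.of_forall fun y z _ => hasFDerivAt_integrand F y z)

theorem contDiff_partialFourierFun (n : ℕ) : ∀ (V : Type) [NormedAddCommGroup V]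
    [NormedSpace ℂ V] (F : 𝓢(E × E, V)), ContDiff ℝ n (partialFourierFun F) := by
  induction n with
  | zero =>
    intro V _ _ F
    exact contDiff_zero.2 (continuous_iff_continuousAt.2 fun z =>
      (hasFDerivAt_partialFourierFun F z).continuousAt)
  | succ n ih =>
    intro V _ _ F
    have hf : fderiv ℝ (partialFourierFun F) = partialFourierFun (V := (E × E) →L[ℝ] V) (dTot F) :=
      funext fun z => (hasFDerivAt_partialFourierFun F z).fderiv
    rw [Nat.cast_succ, contDiff_succ_iff_fderiv]
    refine ⟨fun z => (hasFDerivAt_partialFourierFun F z).differentiableAt, by simp, ?_⟩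
    rw [hf]; exact ih _ _

theorem partialFourierFun_bound (k n : ℕ) : ∀ (V : Type) [NormedAddCommGroup V]
    [NormedSpace ℂ V], ∃ (s : Finset (ℕ × ℕ)) (C : ℝ), 0 ≤ C ∧ ∀ (F : 𝓢(E × E, V)) (z : E × E),
      ‖z‖ ^ k * ‖iteratedFDeriv ℝ n (partialFourierFun F) z‖ ≤
        C * s.sup (schwartzSeminormFamily ℝ (E × E) V) F := by
  induction n with
  | zero =>
    intro V _ _
    obtain ⟨s, C, hC, h⟩ := partialFourierFun_bound_aux (E := E) k 0 V
    obtain ⟨s', C', hC', h'⟩ := partialFourierFun_bound_aux (E := E) 0 k V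
    refine ⟨s ∪ s', C + C', by positivity, fun F z => ?_⟩
    rw [norm_iteratedFDeriv_zero]
    have m1 : s.sup (schwartzSeminormFamily ℝ (E × E) V) F ≤
      (s ∪ s').sup (schwartzSeminormFamily ℝ (E × E) V) F :=
      (Finset.sup_mono (f := schwartzSeminormFamily ℝ (E × E) V) Finset.subset_union_left) F
    have m2 : s'.sup (schwartzSeminormFamily ℝ (E × E) V) F ≤
      (s ∪ s').sup (schwartzSeminormFamily ℝ (E × E) V) F :=
      (Finset.sup_mono (f := schwartzSeminormFamily ℝ (E × E) V) Finset.subset_union_right) F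
    have hz : ‖z‖ ^ k ≤ ‖z.1‖ ^ k + ‖z.2‖ ^ k := by
      rw [Prod.norm_def]
      rcases max_cases ‖z.1‖ ‖z.2‖ with ⟨e, _⟩ | ⟨e, _⟩ <;> rw [e]
      · exact le_add_of_nonneg_right (by positivity)
      · exact le_add_of_nonneg_left (by positivity)
    have a1 := h F z
    have a2 := h' F z
    simp only [pow_zero, mul_one, one_mul] at a1 a2
    calc _ ≤ (‖z.1‖ ^ k + ‖z.2‖ ^ k) * ‖partialFourierFun F z‖ := by gcongr
      _ ≤ C * s.sup (schwartzSeminormFamily ℝ (E × E) V) F +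
        C' * s'.sup (schwartzSeminormFamily ℝ (E × E) V) F := by rw [add_mul]; gcongr
      _ ≤ _ := by rw [add_mul]; gcongr
  | succ n ih =>
    intro V _ _
    obtain ⟨s, C, hC, h⟩ := ih ((E × E) →L[ℝ] V)
    obtain ⟨s', C', hC', h'⟩ := seminorm_comp_bound (dTot (E := E) (V := V)) s
    refine ⟨s', C * C', by positivity, fun F z => ?_⟩
    have hf : fderiv ℝ (partialFourierFun F) = partialFourierFun (V := (E × E) →L[ℝ] V) (dTot F) :=
      funext fun z => (hasFDerivAt_partialFourierFun F z).fderiv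
    rw [← norm_iteratedFDeriv_fderiv, hf]
    calc _ ≤ C * s.sup (schwartzSeminormFamily ℝ (E × E) _) (dTot F) := h _ _
      _ ≤ C * (C' * s'.sup (schwartzSeminormFamily ℝ (E × E) V) F) := by
        gcongr; exact h' F
      _ = _ := by ring

/-- The partial Fourier transform in the second variable on Schwartz functions. -/
def partialFourier : 𝓢(E × E, V) →L[ℝ] 𝓢(E × E, V) :=
  mkCLM partialFourierFun
    (fun F G z => by
      have := congrArg (fun f => f z.2) (fourier_add (slice F z.1) (slice G z.1))
      exact this)
    (fun c F z => by
      have := congrArg (fun f => f z.2) (fourier_smul c (slice F z.1))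
      exact this)
    (fun F => contDiff_infty.2 fun n => contDiff_partialFourierFun n V F)
    (fun n => partialFourierFun_bound n.1 n.2 V)

end PartialFourier

section Tensor
set_option linter.unusedSectionVars false
variable {E : Type} [NormedAddCommGroup E] [InnerProductSpace ℝ E] [FiniteDimensional ℝ E]
  [MeasurableSpace E] [BorelSpace E]

theorem norm_iteratedFDeriv_comp_fst_le (f : 𝓢(E, ℂ)) (i : ℕ) (z : E × E) :
    ‖iteratedFDeriv ℝ i (fun w : E × E => f w.1) z‖ ≤ ‖iteratedFDeriv ℝ i f z.1‖ := by
  have h := (ContinuousLinearMap.fst ℝ E E).iteratedFDeriv_comp_right (f.smooth ⊤) z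
    (i := i) (mod_cast le_top)
  have e : iteratedFDeriv ℝ i (fun w : E × E => f w.1) z = _ := h
  rw [e]
  refine (ContinuousMultilinearMap.norm_compContinuousLinearMap_le _ _).trans ?_
  refine mul_le_of_le_one_right (norm_nonneg _) ?_
  exact Finset.prod_le_one (fun _ _ => norm_nonneg _)
    (fun _ _ => ContinuousLinearMap.norm_fst_le ℝ E E)

theorem norm_iteratedFDeriv_comp_snd_le (f : 𝓢(E, ℂ)) (i : ℕ) (z : E × E) :
    ‖iteratedFDeriv ℝ i (fun w : E × E => f w.2) z‖ ≤ ‖iteratedFDeriv ℝ i f z.2‖ := by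
  have h := (ContinuousLinearMap.snd ℝ E E).iteratedFDeriv_comp_right (f.smooth ⊤) z
    (i := i) (mod_cast le_top)
  have e : iteratedFDeriv ℝ i (fun w : E × E => f w.2) z = _ := h
  rw [e]
  refine (ContinuousMultilinearMap.norm_compContinuousLinearMap_le _ _).trans ?_
  refine mul_le_of_le_one_right (norm_nonneg _) ?_
  exact Finset.prod_le_one (fun _ _ => norm_nonneg _)
    (fun _ _ => ContinuousLinearMap.norm_snd_le ℝ E E)

/-- The tensor product `(f ⊗ g)(x, y) = f x * g y` of Schwartz functions, as a continuous map
of `f`. -/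
def tensor (g : 𝓢(E, ℂ)) : 𝓢(E, ℂ) →L[ℝ] 𝓢(E × E, ℂ) :=
  mkCLM (fun f z => f z.1 * g z.2)
    (fun f₁ f₂ z => by simp [add_mul]) (fun c f z => by simp [mul_assoc])
    (fun f => ((f.smooth ⊤).comp contDiff_fst).mul ((g.smooth ⊤).comp contDiff_snd)) <| by
  rintro ⟨k, n⟩
  refine ⟨Finset.Iic (k, n), ∑ i ∈ Finset.range (n + 1), (n.choose i : ℝ) *
    (SchwartzMap.seminorm ℝ 0 (n - i) g + SchwartzMap.seminorm ℝ k (n - i) g),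
    Finset.sum_nonneg fun i _ => mul_nonneg (by positivity)
      (add_nonneg (apply_nonneg _ _) (apply_nonneg _ _)), fun f z => ?_⟩
  have hz : ‖z‖ ^ k ≤ ‖z.1‖ ^ k + ‖z.2‖ ^ k := by
    rw [Prod.norm_def]
    rcases max_cases ‖z.1‖ ‖z.2‖ with ⟨e, _⟩ | ⟨e, _⟩ <;> rw [e]
    · exact le_add_of_nonneg_right (by positivity)
    · exact le_add_of_nonneg_left (by positivity)
  have hf : ∀ a b, a ≤ k → b ≤ n → SchwartzMap.seminorm ℝ a b f ≤
      (Finset.Iic (k, n)).sup (schwartzSeminormFamily ℝ E ℂ) f := fun a b ha hb =>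
    (Finset.le_sup (f := schwartzSeminormFamily ℝ E ℂ)
      (Finset.mem_Iic.2 (Prod.mk_le_mk.2 ⟨ha, hb⟩) : (a, b) ∈ Finset.Iic (k, n))) f
  have h := norm_iteratedFDeriv_mul_le (𝕜 := ℝ) (N := ((⊤ : ℕ∞) : WithTop ℕ∞))
    ((f.smooth ⊤).comp (contDiff_fst (E := E) (F := E)))
    ((g.smooth ⊤).comp (contDiff_snd (E := E) (F := E))) z (n := n) (mod_cast le_top)
  refine (mul_le_mul_of_nonneg_left h (by positivity)).trans ?_
  rw [Finset.mul_sum, Finset.sum_mul]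
  refine Finset.sum_le_sum fun i hi => ?_
  have hi' : i ≤ n := Nat.lt_succ_iff.1 (Finset.mem_range.1 hi)
  have h1 := norm_iteratedFDeriv_comp_fst_le f i z
  have h2 := norm_iteratedFDeriv_comp_snd_le g (n - i) z
  have f0 := f.norm_iteratedFDeriv_le_seminorm ℝ i z.1
  have fk := f.le_seminorm ℝ k i z.1
  have g0 := g.norm_iteratedFDeriv_le_seminorm ℝ (n - i) z.2
  have gk := g.le_seminorm ℝ k (n - i) z.2
  have F0 := hf 0 i (Nat.zero_le _) hi'
  have Fk := hf k i le_rfl hi'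
  have key : ‖z‖ ^ k * (‖iteratedFDeriv ℝ i f z.1‖ * ‖iteratedFDeriv ℝ (n - i) g z.2‖) ≤
      (SchwartzMap.seminorm ℝ 0 (n - i) g + SchwartzMap.seminorm ℝ k (n - i) g) *
        (Finset.Iic (k, n)).sup (schwartzSeminormFamily ℝ E ℂ) f := by
    calc _ ≤ (‖z.1‖ ^ k + ‖z.2‖ ^ k) *
          (‖iteratedFDeriv ℝ i f z.1‖ * ‖iteratedFDeriv ℝ (n - i) g z.2‖) := by gcongr
      _ = (‖iteratedFDeriv ℝ (n - i) g z.2‖) * (‖z.1‖ ^ k * ‖iteratedFDeriv ℝ i f z.1‖) +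
          (‖z.2‖ ^ k * ‖iteratedFDeriv ℝ (n - i) g z.2‖) * ‖iteratedFDeriv ℝ i f z.1‖ := by ring
      _ ≤ SchwartzMap.seminorm ℝ 0 (n - i) g *
            (Finset.Iic (k, n)).sup (schwartzSeminormFamily ℝ E ℂ) f +
          SchwartzMap.seminorm ℝ k (n - i) g *
            (Finset.Iic (k, n)).sup (schwartzSeminormFamily ℝ E ℂ) f :=
        add_le_add (mul_le_mul g0 (fk.trans Fk) (by positivity) (apply_nonneg _ _))
          (mul_le_mul gk (f0.trans F0) (by positivity) (apply_nonneg _ _))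
      _ = _ := by ring
  calc _ ≤ ‖z‖ ^ k * ((n.choose i : ℝ) * ‖iteratedFDeriv ℝ i f z.1‖ *
        ‖iteratedFDeriv ℝ (n - i) g z.2‖) := by
        gcongr
        · exact h1
        · exact h2
    _ = (n.choose i : ℝ) * (‖z‖ ^ k * (‖iteratedFDeriv ℝ i f z.1‖ *
        ‖iteratedFDeriv ℝ (n - i) g z.2‖)) := by ring
    _ ≤ (n.choose i : ℝ) * _ := mul_le_mul_of_nonneg_left key (by positivity)
    _ = _ := by ring

/-- Complex conjugation of Schwartz functions. -/
def conjS {D : Type} [NormedAddCommGroup D] [NormedSpace ℝ D] : 𝓢(D, ℂ) →L[ℝ] 𝓢(D, ℂ) :=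
  postcompCLM (Complex.conjCLE : ℂ →L[ℝ] ℂ)

theorem conjS_apply {D : Type} [NormedAddCommGroup D] [NormedSpace ℝ D] (f : 𝓢(D, ℂ)) (x : D) :
    conjS f x = (starRingEnd ℂ) (f x) := rfl

/-- The sesquilinear pairing `⟨u, g⟩` of a tempered distribution and a Schwartz function,
extending `∫ u(t) * conj (g t) dt` (conjugate-linear in `g`). -/
def sesq {D : Type} [NormedAddCommGroup D] [NormedSpace ℝ D] (u : 𝓢'(D, ℂ)) (g : 𝓢(D, ℂ)) : ℂ :=
  u (conjS g)

/-- The linear change of variables `(x, y) ↦ (x + τ y, x - (1 - τ) y)`. -/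
def shear (E : Type) [NormedAddCommGroup E] [InnerProductSpace ℝ E] (τ : ℝ) :
    (E × E) ≃L[ℝ] (E × E) :=
  ContinuousLinearEquiv.equivOfInverse
    ((ContinuousLinearMap.fst ℝ E E + τ • ContinuousLinearMap.snd ℝ E E).prod
      (ContinuousLinearMap.fst ℝ E E - (1 - τ) • ContinuousLinearMap.snd ℝ E E))
    (((1 - τ) • ContinuousLinearMap.fst ℝ E E + τ • ContinuousLinearMap.snd ℝ E E).prod
      (ContinuousLinearMap.fst ℝ E E - ContinuousLinearMap.snd ℝ E E))
    (fun z => by ext <;> simp <;> module)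
    (fun z => by ext <;> (simp; module))

theorem shear_apply (τ : ℝ) (z : E × E) :
    shear E τ z = (z.1 + τ • z.2, z.1 - (1 - τ) • z.2) := rfl

end Tensor

/-- `ℝᵈ`. -/
abbrev Space (d : ℕ) : Type := EuclideanSpace ℝ (Fin d)

/-- Phase space `ℝ²ᵈ`, with points `z = (x, ω)`. -/
abbrev Phase (d : ℕ) : Type := EuclideanSpace ℝ (Fin d ⊕ Fin d)

/-- The position component `x` of `z = (x, ω)`. -/
def pos {d : ℕ} (z : Phase d) : Space d := (EuclideanSpace.sumEquivProd (𝕜 := ℝ) z).1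

/-- The frequency component `ω` of `z = (x, ω)`. -/
def freq {d : ℕ} (z : Phase d) : Space d := (EuclideanSpace.sumEquivProd (𝕜 := ℝ) z).2

theorem pos_apply {d : ℕ} (z : Phase d) (i : Fin d) : pos z i = z (Sum.inl i) := rfl

theorem freq_apply {d : ℕ} (z : Phase d) (i : Fin d) : freq z i = z (Sum.inr i) := rfl

/-- The cross-`τ`-Wigner distribution `W_τ(f, g)` of two Schwartz functions: the partial Fourier
transform, in the second variable, of `f(x + τ y) * conj (g(x - (1 - τ) y))`. -/
def wigner {d : ℕ} (τ : ℝ) (f g : 𝓢(Space d, ℂ)) : 𝓢(Phase d, ℂ) :=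
  compCLMOfContinuousLinearEquiv ℝ (EuclideanSpace.sumEquivProd (𝕜 := ℝ))
    (partialFourier (compCLMOfContinuousLinearEquiv ℝ (shear (Space d) τ) (tensor (conjS g) f)))

theorem wigner_apply {d : ℕ} (τ : ℝ) (f g : 𝓢(Space d, ℂ)) (z : Phase d) :
    wigner τ f g z = ∫ y : Space d, Complex.exp (-2 * Real.pi * Complex.I * inner ℝ y (freq z)) *
      (f (pos z + τ • y) * (starRingEnd ℂ) (g (pos z - (1 - τ) • y))) := by
  refine (partialFourierFun_eq _ _).trans (integral_congr_ae (Filter.Eventually.of_forall fun y => ?_))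
  simp only [ftIntegrand, Circle.smul_def, Real.fourierChar_apply, smul_eq_mul]
  refine congrArg₂ (· * ·) (congrArg Complex.exp ?_) rfl
  change _ = -2 * Real.pi * Complex.I * (inner ℝ y (EuclideanSpace.sumEquivProd (𝕜 := ℝ) z).2 : ℝ)
  push_cast
  ring

/-- The continuous linear map `ψ ↦ conj (W_τ(conj ψ, f))` on Schwartz functions. -/
def wignerDual {d : ℕ} (τ : ℝ) (f : 𝓢(Space d, ℂ)) : 𝓢(Space d, ℂ) →L[ℂ] 𝓢(Phase d, ℂ) where
  toFun ψ := conjS (wigner τ (conjS ψ) f)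
  map_add' ψ₁ ψ₂ := by simp only [wigner, map_add]
  map_smul' c ψ := by
    ext z
    simp only [smul_apply, conjS_apply, wigner_apply, smul_eq_mul, map_mul, RingHom.id_apply]
    rw [← integral_conj, ← integral_conj, ← integral_const_mul]
    refine integral_congr_ae (Filter.Eventually.of_forall fun y => ?_)
    simp only [map_mul, Complex.conj_conj]
    ring
  cont := by
    simp only [wigner]
    fun_prop

theorem wignerDual_add {d : ℕ} (τ : ℝ) (f₁ f₂ ψ : 𝓢(Space d, ℂ)) :
    wignerDual τ (f₁ + f₂) ψ = wignerDual τ f₁ ψ + wignerDual τ f₂ ψ := by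
  have h : tensor (conjS (f₁ + f₂)) (conjS ψ) =
      tensor (conjS f₁) (conjS ψ) + tensor (conjS f₂) (conjS ψ) := by
    ext z
    change conjS ψ z.1 * conjS (f₁ + f₂) z.2 =
      conjS ψ z.1 * conjS f₁ z.2 + conjS ψ z.1 * conjS f₂ z.2
    simp only [map_add, add_apply, mul_add]
  change conjS (wigner τ (conjS ψ) (f₁ + f₂)) =
    conjS (wigner τ (conjS ψ) f₁) + conjS (wigner τ (conjS ψ) f₂)
  rw [wigner, h]
  simp only [wigner, map_add]

theorem wignerDual_smul {d : ℕ} (τ : ℝ) (c : ℂ) (f ψ : 𝓢(Space d, ℂ)) :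
    wignerDual τ (c • f) ψ = c • wignerDual τ f ψ := by
  change conjS (wigner τ (conjS ψ) (c • f)) = c • conjS (wigner τ (conjS ψ) f)
  ext z
  simp only [smul_apply, conjS_apply, wigner_apply, smul_eq_mul, map_mul]
  rw [← integral_conj, ← integral_conj, ← integral_const_mul]
  refine integral_congr_ae (Filter.Eventually.of_forall fun y => ?_)
  simp only [map_mul, Complex.conj_conj]
  ring

/-- The `τ`-pseudodifferential operator with symbol `σ`, a linear map from Schwartz functions to
tempered distributions, determined by `⟨Op_τ(σ) f, g⟩ = ⟨σ, W_τ(g, f)⟩` (see `sesq_opTau`). -/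
def opTau {d : ℕ} (τ : ℝ) (σ : 𝓢'(Phase d, ℂ)) : 𝓢(Space d, ℂ) →ₗ[ℂ] 𝓢'(Space d, ℂ) where
  toFun f := PointwiseConvergenceCLM.precomp ℂ (wignerDual τ f) σ
  map_add' f₁ f₂ := by
    ext ψ
    change σ (wignerDual τ (f₁ + f₂) ψ) = σ (wignerDual τ f₁ ψ) + σ (wignerDual τ f₂ ψ)
    rw [wignerDual_add, map_add]
  map_smul' c f := by
    ext ψ
    change σ (wignerDual τ (c • f) ψ) = c • σ (wignerDual τ f ψ)
    rw [wignerDual_smul, map_smul]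

theorem sesq_opTau {d : ℕ} (τ : ℝ) (σ : 𝓢'(Phase d, ℂ)) (f g : 𝓢(Space d, ℂ)) :
    sesq (opTau τ σ f) g = sesq σ (wigner τ g f) := by
  have h : conjS (conjS g) = g := by ext x; simp [conjS_apply]
  change σ (conjS (wigner τ (conjS (conjS g)) f)) = σ (conjS (wigner τ g f))
  rw [h]

section TimeFrequencyShifts
variable {D : Type} [NormedAddCommGroup D] [InnerProductSpace ℝ D]

/-- The time-frequency shift `π(x, ω) g (t) = exp(2πi ω·t) g(t - x)` on Schwartz functions. -/
def tfShift (x ω : D) (g : 𝓢(D, ℂ)) : 𝓢(D, ℂ) :=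
  smulLeftCLM ℂ (fun t : D => Complex.exp (2 * Real.pi * Complex.I * inner ℝ ω t))
    (compSubConstCLM ℂ x g)

theorem hasTemperateGrowth_modulation (ω : D) : Function.HasTemperateGrowth
    (fun t : D => Complex.exp (2 * Real.pi * Complex.I * inner ℝ ω t)) := by
  have h : Function.HasTemperateGrowth
      (fun s : ℝ => Complex.exp (2 * Real.pi * Complex.I * s)) := by
    refine ⟨(contDiff_const.mul Complex.ofRealCLM.contDiff).cexp, fun n => ⟨0, (2 * Real.pi) ^ n, fun s => ?_⟩⟩
    rw [norm_iteratedFDeriv_eq_norm_iteratedDeriv]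
    have : iteratedDeriv n (fun s : ℝ => Complex.exp (2 * Real.pi * Complex.I * s)) =
        fun s : ℝ => (2 * Real.pi * Complex.I) ^ n * Complex.exp (2 * Real.pi * Complex.I * s) := by
      induction n with
      | zero => simp
      | succ n ih =>
        rw [iteratedDeriv_succ, ih]
        funext s
        have h1 : HasDerivAt (fun s : ℝ => 2 * Real.pi * Complex.I * (s : ℂ))
            (2 * Real.pi * Complex.I) s := by
          simpa using (Complex.ofRealCLM.hasDerivAt (x := s)).const_mul (2 * Real.pi * Complex.I)
        rw [(h1.cexp.const_mul _).deriv]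
        ring
    rw [this]
    have e : 2 * (Real.pi : ℂ) * Complex.I * s = ((2 * Real.pi * s : ℝ) : ℂ) * Complex.I := by
      push_cast; ring
    simp only [norm_mul, norm_pow, e, Complex.norm_exp_ofReal_mul_I]
    simp [abs_of_pos Real.pi_pos]
  exact h.comp (Function.hasTemperateGrowth_inner_right ω)

theorem tfShift_apply (x ω : D) (g : 𝓢(D, ℂ)) (t : D) :
    tfShift x ω g t = Complex.exp (2 * Real.pi * Complex.I * inner ℝ ω t) * g (t - x) := by
  rw [tfShift, smulLeftCLM_apply_apply (hasTemperateGrowth_modulation ω)]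
  rfl

/-- The short-time Fourier transform `V_g f (x, ω) = ⟨f, π(x, ω) g⟩`. -/
def stft (g : 𝓢(D, ℂ)) (f : 𝓢'(D, ℂ)) (x ω : D) : ℂ := sesq f (tfShift x ω g)

/-- The polynomial weight `v_s(z) = (1 + |z|²)^(s/2)`. -/
def weight (s : ℝ) (z : D) : ℝ := (1 + ‖z‖ ^ 2) ^ (s / 2)

/-- The norm of the Wiener amalgam space `W(𝓕 L^p_u, L^q_w)` on `D`, with window `g`:
the `L^p` norm in the frequency variable, weighted by `u`, is taken first; then the `L^q` norm
in the position variable, weighted by `w`. -/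
def amalgamNorm [MeasureSpace D] (g : 𝓢(D, ℂ)) (p q : ℝ≥0∞) (u w : D → ℝ)
    (f : 𝓢'(D, ℂ)) : ℝ≥0∞ :=
  eLpNorm (fun x => eLpNorm (fun ω => stft g f x ω * u ω) p volume * ENNReal.ofReal (w x))
    q volume

/-- The Wiener amalgam space `W(𝓕 L^p_u, L^q_w)` on `D`, defined by means of the window `g`. -/
def wienerAmalgam [MeasureSpace D] (g : 𝓢(D, ℂ)) (p q : ℝ≥0∞) (u w : D → ℝ) : Set 𝓢'(D, ℂ) :=
  {f | amalgamNorm g p q u w f < ⊤}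

end TimeFrequencyShifts

/-- `π(z)` for `z = (x, ω)` in phase space. -/
def phaseShift {d : ℕ} (z : Phase d) (g : 𝓢(Space d, ℂ)) : 𝓢(Space d, ℂ) :=
  tfShift (pos z) (freq z) g

/-- `z ↦ V_g f(z) m(z)` on phase space. -/
def weightedSTFT {d : ℕ} (g : 𝓢(Space d, ℂ)) (m : Phase d → ℝ) (f : 𝓢'(Space d, ℂ))
    (z : Phase d) : ℂ :=
  stft g f (pos z) (freq z) * m z

/-- The modulation space `M^p_m(ℝᵈ)`, defined by means of the window `g`: the tempered
distributions `f` with `V_g f · m ∈ L^p(ℝ²ᵈ)`. -/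
def modulationSpace {d : ℕ} (g : 𝓢(Space d, ℂ)) (p : ℝ≥0∞) (m : Phase d → ℝ) :
    Submodule ℂ 𝓢'(Space d, ℂ) where
  carrier := {f | MemLp (weightedSTFT g m f) p volume}
  zero_mem' := by
    have h : weightedSTFT g m 0 = 0 := by
      funext z; simp [weightedSTFT, stft, sesq]
    change MemLp (weightedSTFT g m 0) p volume
    rw [h]; exact MemLp.zero
  add_mem' {f₁ f₂} h₁ h₂ := by
    have h : weightedSTFT g m (f₁ + f₂) = weightedSTFT g m f₁ + weightedSTFT g m f₂ := by
      funext z; simp [weightedSTFT, stft, sesq, add_mul]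
    change MemLp (weightedSTFT g m (f₁ + f₂)) p volume
    rw [h]; exact MemLp.add h₁ h₂
  smul_mem' c f hf := by
    have h : weightedSTFT g m (c • f) = c • weightedSTFT g m f := by
      funext z; simp [weightedSTFT, stft, sesq, mul_assoc]
    change MemLp (weightedSTFT g m (c • f)) p volume
    rw [h]; exact MemLp.const_smul hf c

/-- The norm `‖V_g f · m‖_{L^p}` of `M^p_m(ℝᵈ)`, with window `g`. -/
def modulationNorm {d : ℕ} (g : 𝓢(Space d, ℂ)) (p : ℝ≥0∞) (m : Phase d → ℝ)
    (f : 𝓢'(Space d, ℂ)) : ℝ≥0∞ :=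
  eLpNorm (weightedSTFT g m f) p volume

/-- An operator `T`, defined on Schwartz functions, is bounded on `M^p_m(ℝᵈ)`: the Schwartz space
is contained in `M^p_m` and `T` extends to a bounded linear operator `S` of `M^p_m` into itself.
The Schwartz space need not be norm-dense (when `p = ∞`), so the extension is required to be the
canonical one: `S` respects weak convergence of norm-bounded sequences. -/
def IsBoundedOnModulationSpace {d : ℕ} (g : 𝓢(Space d, ℂ)) (p : ℝ≥0∞) (m : Phase d → ℝ)
    (T : 𝓢(Space d, ℂ) →ₗ[ℂ] 𝓢'(Space d, ℂ)) : Prop :=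
  ∃ S : modulationSpace g p m →ₗ[ℂ] modulationSpace g p m,
    (∀ f : 𝓢(Space d, ℂ), ∃ hf : toTemperedDistributionCLM (Space d) ℂ volume f ∈
        modulationSpace g p m,
      (S ⟨toTemperedDistributionCLM (Space d) ℂ volume f, hf⟩ : 𝓢'(Space d, ℂ)) = T f) ∧
    (∃ C : ℝ≥0, ∀ f : modulationSpace g p m,
      modulationNorm g p m (S f : 𝓢'(Space d, ℂ)) ≤ C * modulationNorm g p m f) ∧
    (∀ (u : ℕ → modulationSpace g p m) (f : modulationSpace g p m),
      (∃ C : ℝ≥0, ∀ n, modulationNorm g p m (u n) ≤ C) →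
      (∀ ψ : 𝓢(Space d, ℂ), Filter.Tendsto (fun n => (u n : 𝓢'(Space d, ℂ)) ψ) Filter.atTop
        (nhds ((f : 𝓢'(Space d, ℂ)) ψ))) →
      ∀ ψ : 𝓢(Space d, ℂ), Filter.Tendsto (fun n => (S (u n) : 𝓢'(Space d, ℂ)) ψ) Filter.atTop
        (nhds ((S f : 𝓢'(Space d, ℂ)) ψ)))

/-- The matrix `U_τ = - diag(τ/(1-τ) I, (1-τ)/τ I)`. -/
def tauMatrix (d : ℕ) (τ : ℝ) : Matrix (Fin d ⊕ Fin d) (Fin d ⊕ Fin d) ℝ :=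
  -Matrix.fromBlocks ((τ / (1 - τ)) • 1) 0 0 (((1 - τ) / τ) • 1)

theorem tauMatrix_mem {d : ℕ} {τ : ℝ} (h0 : τ ≠ 0) (h1 : τ ≠ 1) :
    tauMatrix d τ ∈ Matrix.symplecticGroup (Fin d) ℝ := by
  have h1' : (1 : ℝ) - τ ≠ 0 := sub_ne_zero.2 h1.symm
  refine SymplecticGroup.neg_mem ?_
  rw [SymplecticGroup.mem_iff, Matrix.J, Matrix.fromBlocks_transpose, Matrix.fromBlocks_multiply,
    Matrix.fromBlocks_multiply]
  congr 1 <;> simp [smul_smul, h0, h1']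

/-- The class of generalized metaplectic operators for `A` and `v_s`, `A` symplectic,
with window `g`: linear operators `T` from Schwartz functions to tempered distributions such that
`|⟨T π(z) g, π(w) g⟩| ≤ H(w - A z)` for all `z`, `w`, for some `H ∈ L^1_{v_s}(ℝ²ᵈ)`. -/
def generalizedMetaplectic {d : ℕ} (g : 𝓢(Space d, ℂ)) (A : Matrix.symplecticGroup (Fin d) ℝ) (s : ℝ) :
    Set (𝓢(Space d, ℂ) →ₗ[ℂ] 𝓢'(Space d, ℂ)) :=
  {T | ∃ H : Phase d → ℝ, Integrable (fun z => H z * weight s z) volume ∧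
    ∀ w z : Phase d, ‖sesq (T (phaseShift z g)) (phaseShift w g)‖ ≤
      H (w - Matrix.toEuclideanCLM (𝕜 := ℝ) (A : Matrix (Fin d ⊕ Fin d) (Fin d ⊕ Fin d) ℝ) z)}

end TimeFrequency
end

open TimeFrequency SchwartzMap
open scoped ENNReal

/-! The theorem rests on the size of the matrix elements ⟨Op_τ(σ)π(z)f, π(w)g⟩. Shifting both
arguments of W_τ(g,f) in time and frequency shifts W_τ(g,f) itself, up to a unimodular factor
(`wigner_phaseShift`). The matrix element therefore has the modulus of an STFT of σ with window
W_τ(g,f), at a position and a frequency that are linear in (w,z). The norm of W(𝓕L^∞, L^1_{v_s})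
takes the supremum over the frequency, so only the position counts, and the position is D(w - U_τ z)
with D = diag(1-τ, τ) (`wignerCenter_eq`). This is where U_τ comes from, and D is invertible because
τ is neither 0 nor 1. A majorant of the STFT in L^1_{v_s}, valid for every window
(`exists_majorant`), composed with D, is the function H of part (i).

The change of window uses the reproducing formula of the STFT, paired with a tempered distribution
(`stft_orthogonality`). It requires exchanging a continuous functional on 𝓢 with an 𝓢-valued
integral (`integral_functional`).

For part (ii), f = ‖φ‖⁻² ∫ V_φ f(z) π(z)φ dz suggests defining the extension weakly as ‖φ‖⁻² ∫ V_φ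
f(z) Op_τ(σ)π(z)φ dz. The integral converges because V_φ f is bounded on M^p_{v_s}
(`exists_enorm_phaseSTFT_le`) and because the matrix elements with w = 0 are integrable in z. By
inversion the extension agrees with Op_τ(σ) on 𝓢. Its STFT is dominated by an integral operator with
kernel H(w - U_τ z), so submultiplicativity of v_s and Schur's test (`eLpNorm_le_of_schur`) give the
norm bound for all p, including p = ∞, where density of 𝓢 is not available. Weak sequential
continuity is dominated convergence in the defining integral. -/

noncomputable section
namespace TimeFrequency

/-! ### Integrals of Schwartz-valued functions and continuous functionals. -/

section WeakIntegral
variable {D : Type} [NormedAddCommGroup D] [NormedSpace ℝ D]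

open scoped BoundedContinuousFunction

variable (D) in
/-- The space of bounded continuous functions with values in `n`-linear maps. -/
def DerivBCF (n : ℕ) : Type := D →ᵇ (D [×n]→L[ℝ] ℂ)

instance (n : ℕ) : NormedAddCommGroup (DerivBCF D n) :=
  inferInstanceAs (NormedAddCommGroup (D →ᵇ (D [×n]→L[ℝ] ℂ)))

instance (n : ℕ) : NormedSpace ℝ (DerivBCF D n) :=
  inferInstanceAs (NormedSpace ℝ (D →ᵇ (D [×n]→L[ℝ] ℂ)))

instance (n : ℕ) : CompleteSpace (DerivBCF D n) :=
  inferInstanceAs (CompleteSpace (D →ᵇ (D [×n]→L[ℝ] ℂ)))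

/-- Evaluation at a point. -/
def DerivBCF.eval (n : ℕ) (t : D) : DerivBCF D n →L[ℝ] (D [×n]→L[ℝ] ℂ) :=
  LinearMap.mkContinuous
    { toFun := fun f => (show D →ᵇ (D [×n]→L[ℝ] ℂ) from f) t
      map_add' := fun _ _ => rfl
      map_smul' := fun _ _ => rfl } 1
    fun f => (BoundedContinuousFunction.norm_coe_le_norm
      (show D →ᵇ (D [×n]→L[ℝ] ℂ) from f) t).trans (one_mul _).ge

theorem DerivBCF.ext {n : ℕ} {f g : DerivBCF D n} (h : ∀ t, eval n t f = eval n t g) : f = g :=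
  BoundedContinuousFunction.ext h

theorem DerivBCF.norm_le {n : ℕ} {f : DerivBCF D n} {C : ℝ} (hC : 0 ≤ C)
    (h : ∀ t, ‖eval n t f‖ ≤ C) : ‖f‖ ≤ C :=
  (BoundedContinuousFunction.norm_le hC).2 h

theorem DerivBCF.norm_eval_le {n : ℕ} (f : DerivBCF D n) (t : D) : ‖eval n t f‖ ≤ ‖f‖ :=
  BoundedContinuousFunction.norm_coe_le_norm (show D →ᵇ (D [×n]→L[ℝ] ℂ) from f) t

/-- The weighted derivative `‖t‖ ^ k * Dⁿ f (t)` as a bounded continuous function. -/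
def weightedDerivFun (k n : ℕ) (f : 𝓢(D, ℂ)) : DerivBCF D n :=
  BoundedContinuousFunction.ofNormedAddCommGroup (fun t : D => ‖t‖ ^ k • iteratedFDeriv ℝ n f t)
    ((continuous_norm.pow k).smul ((f.smooth n).continuous_iteratedFDeriv le_rfl))
    (SchwartzMap.seminorm ℝ k n f) (fun t => by
      rw [norm_smul, norm_pow, norm_norm]; exact f.le_seminorm ℝ k n t)

theorem eval_weightedDerivFun (k n : ℕ) (f : 𝓢(D, ℂ)) (t : D) :
    DerivBCF.eval n t (weightedDerivFun k n f) = ‖t‖ ^ k • iteratedFDeriv ℝ n f t := rfl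

theorem norm_weightedDerivFun_le (k n : ℕ) (f : 𝓢(D, ℂ)) :
    ‖weightedDerivFun k n f‖ ≤ SchwartzMap.seminorm ℝ k n f := by
  refine DerivBCF.norm_le (apply_nonneg _ _) fun t => ?_
  rw [eval_weightedDerivFun, norm_smul, norm_pow, norm_norm]
  exact f.le_seminorm ℝ k n t

/-- `weightedDerivFun` as a continuous linear map. -/
def weightedDeriv (k n : ℕ) : 𝓢(D, ℂ) →L[ℝ] DerivBCF D n :=
  mkCLMtoNormedSpace (σ := RingHom.id ℝ) (fun f : 𝓢(D, ℂ) => weightedDerivFun k n f)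
    (fun f g => by
      refine DerivBCF.ext fun t => ?_
      simp only [map_add, eval_weightedDerivFun]
      rw [FunLike.coe_add,
        iteratedFDeriv_add_apply (f.smooth n).contDiffAt (g.smooth n).contDiffAt, smul_add])
    (fun c f => by
      refine DerivBCF.ext fun t => ?_
      simp only [map_smul, eval_weightedDerivFun, RingHom.id_apply]
      rw [FunLike.coe_smul, iteratedFDeriv_const_smul_apply (f.smooth n).contDiffAt, smul_comm])
    ⟨{(k, n)}, 1, zero_le_one, fun f => by
      rw [one_mul, Finset.sup_singleton]
      exact norm_weightedDerivFun_le k n f⟩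

theorem eval_weightedDeriv (k n : ℕ) (f : 𝓢(D, ℂ)) (t : D) :
    DerivBCF.eval n t (weightedDeriv k n f) = ‖t‖ ^ k • iteratedFDeriv ℝ n f t := rfl

theorem norm_weightedDeriv_le (k n : ℕ) (f : 𝓢(D, ℂ)) :
    ‖weightedDeriv k n f‖ ≤ SchwartzMap.seminorm ℝ k n f :=
  norm_weightedDerivFun_le k n f

theorem seminorm_le_norm_weightedDeriv (k n : ℕ) (f : 𝓢(D, ℂ)) :
    SchwartzMap.seminorm ℝ k n f ≤ ‖weightedDeriv k n f‖ := by
  refine f.seminorm_le_bound ℝ k n (norm_nonneg _) fun t => ?_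
  have h := (weightedDeriv k n f).norm_eval_le t
  rwa [eval_weightedDeriv, norm_smul, norm_pow, norm_norm] at h

theorem continuous_iteratedFDeriv_apply (n : ℕ) (t : D) :
    Continuous fun f : 𝓢(D, ℂ) => iteratedFDeriv ℝ n f t := by
  have h : Continuous fun f : 𝓢(D, ℂ) => DerivBCF.eval n t (weightedDeriv 0 n f) :=
    (DerivBCF.eval n t).continuous.comp (weightedDeriv 0 n).continuous
  simpa [eval_weightedDeriv] using h

variable {Z : Type} [MeasurableSpace Z] {μ : Measure Z}

/-- Dominated differentiation under the integral sign. The derivative is evaluated at a vector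
because the induction on iterated derivatives below removes one argument at a time. -/
theorem fderiv_integral_apply {V : Type} [NormedAddCommGroup V] [NormedSpace ℝ V] {F : D → Z → V}
    {b : Z → ℝ} (hF : ∀ t, Integrable (F t) μ) (hb : Integrable b μ)
    (hd : ∀ z, Differentiable ℝ fun t => F t z) (hle : ∀ z t, ‖fderiv ℝ (fun t => F t z) t‖ ≤ b z)
    (t : D) (hm : AEStronglyMeasurable (fun z => fderiv ℝ (fun t => F t z) t) μ) (v : D) :
    Integrable (fun z => fderiv ℝ (fun t => F t z) t v) μ ∧
      fderiv ℝ (fun t => ∫ z, F t z ∂μ) t v = ∫ z, fderiv ℝ (fun t => F t z) t v ∂μ := by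
  have hI : Integrable (fun z => fderiv ℝ (fun t => F t z) t) μ :=
    hb.mono' hm (Filter.Eventually.of_forall fun z => hle z t)
  have key := hasFDerivAt_integral_of_dominated_of_fderiv_le (s := Set.univ) (x₀ := t)
    (F' := fun t z => fderiv ℝ (fun t => F t z) t) Filter.univ_mem
    (Filter.Eventually.of_forall fun t => (hF t).aestronglyMeasurable) (hF t) hm
    (Filter.Eventually.of_forall fun z t _ => hle z t) hb
    (Filter.Eventually.of_forall fun z t _ => (hd z t).hasFDerivAt)
  exact ⟨hI.apply_continuousLinearMap v, by
    rw [key.fderiv, ContinuousLinearMap.integral_apply hI]⟩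

variable [TopologicalSpace Z] [OpensMeasurableSpace Z] [SecondCountableTopology Z]

theorem integrable_iteratedFDeriv_apply {γ : Z → 𝓢(D, ℂ)} (hγ : Continuous γ)
    (hint : ∀ k n, Integrable (fun z => SchwartzMap.seminorm ℝ k n (γ z)) μ) (n : ℕ) (t : D) :
    Integrable (fun z => iteratedFDeriv ℝ n (γ z) t) μ := by
  refine (hint 0 n).mono' ((continuous_iteratedFDeriv_apply n t).comp hγ).aestronglyMeasurable
    (Filter.Eventually.of_forall fun z => (γ z).norm_iteratedFDeriv_le_seminorm ℝ n t)

/-- Each induction step differentiates under the integral once more. The seminorm of order (0, n+1)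
of γ z bounds the next derivative uniformly in t, so it serves as integrable majorant. -/
theorem iteratedFDeriv_eq_integral {γ : Z → 𝓢(D, ℂ)} (hγ : Continuous γ)
    (hint : ∀ k n, Integrable (fun z => SchwartzMap.seminorm ℝ k n (γ z)) μ) {G : 𝓢(D, ℂ)}
    (hG : ∀ t, G t = ∫ z, γ z t ∂μ) (n : ℕ) (t : D) :
    iteratedFDeriv ℝ n G t = ∫ z, iteratedFDeriv ℝ n (γ z) t ∂μ := by
  induction n generalizing t with
  | zero =>
    simp only [iteratedFDeriv_zero_eq_comp, Function.comp_apply, hG]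
    exact (((continuousMultilinearCurryFin0 ℝ D ℂ).symm.toContinuousLinearEquiv).integral_comp_comm _).symm
  | succ n ih =>
    have hI := integrable_iteratedFDeriv_apply hγ hint
    have e : ∀ z, fderiv ℝ (iteratedFDeriv ℝ n (γ z)) t =
        continuousMultilinearCurryLeftEquiv ℝ (fun _ : Fin (n + 1) => D) ℂ
          (iteratedFDeriv ℝ (n + 1) (γ z) t) := fun z => by
      rw [iteratedFDeriv_succ_eq_comp_left]; simp
    have hm : AEStronglyMeasurable (fun z => fderiv ℝ (iteratedFDeriv ℝ n (γ z)) t) μ := by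
      simp only [e]
      exact (LinearIsometryEquiv.continuous _).comp_aestronglyMeasurable
        (hI (n + 1) t).aestronglyMeasurable
    have hb : ∀ z t, ‖fderiv ℝ (iteratedFDeriv ℝ n (γ z)) t‖ ≤
        SchwartzMap.seminorm ℝ 0 (n + 1) (γ z) := fun z t => by
      rw [norm_fderiv_iteratedFDeriv]
      exact (γ z).norm_iteratedFDeriv_le_seminorm ℝ (n + 1) t
    have hfun : iteratedFDeriv ℝ n G = fun t => ∫ z, iteratedFDeriv ℝ n (γ z) t ∂μ := funext ih
    ext m
    rw [iteratedFDeriv_succ_apply_left, hfun]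
    have key := fderiv_integral_apply (μ := μ) (F := fun t z => iteratedFDeriv ℝ n (γ z) t)
      (hI n) (hint 0 (n + 1)) (fun z t => ((γ z).smooth (n + 1 : ℕ)).differentiable_iteratedFDeriv
        (by exact_mod_cast n.lt_succ_self) t) hb t hm (m 0)
    have h2 := fun z => iteratedFDeriv_succ_apply_left (𝕜 := ℝ) (f := γ z) (x := t) (n := n) m
    rw [key.2, ContinuousMultilinearMap.integral_apply key.1,
      ContinuousMultilinearMap.integral_apply (hI (n + 1) t)]
    simp only [h2]

/-- A functional dominated by a linear map into a normed space factors through it. -/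
theorem exists_factorization {S X : Type} [AddCommGroup S] [Module ℝ S] [NormedAddCommGroup X]
    [NormedSpace ℝ X] (ι : S →ₗ[ℝ] X) (L : S →ₗ[ℝ] ℝ) (C : ℝ)
    (h : ∀ f, ‖L f‖ ≤ C * ‖ι f‖) : ∃ Λ : StrongDual ℝ X, ∀ f, Λ (ι f) = L f := by
  -- The bound makes L vanish where ι does, so L descends to a bounded functional on the range of ι,
  -- which Hahn–Banach extends.
  have hker : LinearMap.ker ι ≤ LinearMap.ker L := fun f hf => by
    have hf' : ι f = 0 := hf
    have := h f
    rw [hf', norm_zero, mul_zero] at this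
    exact norm_le_zero_iff.1 this
  let Λ₀ : LinearMap.range ι →ₗ[ℝ] ℝ := ((LinearMap.ker ι).liftQ L hker) ∘ₗ
    ι.quotKerEquivRange.symm.toLinearMap
  have hΛ₀ : ∀ f, Λ₀ ⟨ι f, f, rfl⟩ = L f := fun f => by
    have : ι.quotKerEquivRange.symm ⟨ι f, f, rfl⟩ = (LinearMap.ker ι).mkQ f := by
      rw [LinearEquiv.symm_apply_eq]; rfl
    change (LinearMap.ker ι).liftQ L hker (ι.quotKerEquivRange.symm ⟨ι f, f, rfl⟩) = L f
    rw [this]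
    exact Submodule.liftQ_apply _ _ _
  let Λ₁ : StrongDual ℝ (LinearMap.range ι) := Λ₀.mkContinuous C (by
    rintro ⟨_, f, rfl⟩
    exact (congrArg norm (hΛ₀ f)).le.trans (h f))
  obtain ⟨Λ, hΛ, -⟩ := exists_extension_norm_eq _ Λ₁
  exact ⟨Λ, fun f => (hΛ ⟨ι f, f, rfl⟩).trans (hΛ₀ f)⟩

/-- The tuple of weighted derivatives indexed by a finite set. -/
def weightedDerivs (s : Finset (ℕ × ℕ)) :
    𝓢(D, ℂ) →L[ℝ] ((i : s) → DerivBCF D i.1.2) :=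
  ContinuousLinearMap.pi fun i => weightedDeriv i.1.1 i.1.2

theorem sup_seminorm_le_norm_weightedDerivs (s : Finset (ℕ × ℕ)) (f : 𝓢(D, ℂ)) :
    s.sup (schwartzSeminormFamily ℝ D ℂ) f ≤ ‖weightedDerivs s f‖ :=
  Seminorm.finset_sup_apply_le (norm_nonneg _) fun i hi =>
    (seminorm_le_norm_weightedDeriv i.1 i.2 f).trans (norm_le_pi_norm (weightedDerivs s f) ⟨i, hi⟩)

theorem norm_weightedDerivs_le (s : Finset (ℕ × ℕ)) (f : 𝓢(D, ℂ)) :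
    ‖weightedDerivs s f‖ ≤ ∑ i ∈ s, SchwartzMap.seminorm ℝ i.1 i.2 f := by
  refine (pi_norm_le_iff_of_nonneg (Finset.sum_nonneg fun i _ => apply_nonneg _ _)).2 fun i => ?_
  refine (norm_weightedDeriv_le i.1.1 i.1.2 f).trans ?_
  exact Finset.single_le_sum (f := fun i : ℕ × ℕ => SchwartzMap.seminorm ℝ i.1 i.2 f)
    (fun i _ => apply_nonneg _ _) i.2

theorem integrable_weightedDerivs {γ : Z → 𝓢(D, ℂ)} (hγ : Continuous γ)
    (hint : ∀ k n, Integrable (fun z => SchwartzMap.seminorm ℝ k n (γ z)) μ)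
    (s : Finset (ℕ × ℕ)) : Integrable (fun z => weightedDerivs s (γ z)) μ :=
  (integrable_finsetSum s fun i _ => hint i.1 i.2).mono'
    ((weightedDerivs s).continuous.comp hγ).aestronglyMeasurable
    (Filter.Eventually.of_forall fun z => norm_weightedDerivs_le s (γ z))

/-- The right side is a Bochner integral in a finite product of Banach spaces of bounded functions.
Projections and point evaluations are continuous there and separate points, so the claim reduces to
derivatives under the integral. -/
theorem weightedDerivs_eq_integral {γ : Z → 𝓢(D, ℂ)} (hγ : Continuous γ)
    (hint : ∀ k n, Integrable (fun z => SchwartzMap.seminorm ℝ k n (γ z)) μ) {G : 𝓢(D, ℂ)}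
    (hG : ∀ t, G t = ∫ z, γ z t ∂μ) (s : Finset (ℕ × ℕ)) :
    weightedDerivs s G = ∫ z, weightedDerivs s (γ z) ∂μ := by
  have hintι := integrable_weightedDerivs hγ hint s
  funext i
  have h1 := (ContinuousLinearMap.proj (R := ℝ) (φ := fun i : s => DerivBCF D i.1.2)
      i).integral_comp_comm hintι
  have hi := (ContinuousLinearMap.proj (R := ℝ) (φ := fun i : s => DerivBCF D i.1.2)
      i).integrable_comp hintι
  refine Eq.trans ?_ h1
  refine DerivBCF.ext fun t => ?_
  have h2 := (DerivBCF.eval i.1.2 t).integral_comp_comm hi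
  refine Eq.trans ?_ h2
  change ‖t‖ ^ i.1.1 • iteratedFDeriv ℝ i.1.2 G t =
    ∫ z, ‖t‖ ^ i.1.1 • iteratedFDeriv ℝ i.1.2 (γ z) t ∂μ
  rw [integral_smul, iteratedFDeriv_eq_integral hγ hint hG]

/-- Real functionals commute with weak integrals of Schwartz functions. -/
theorem integral_real_functional {γ : Z → 𝓢(D, ℂ)} (hγ : Continuous γ)
    (hint : ∀ k n, Integrable (fun z => SchwartzMap.seminorm ℝ k n (γ z)) μ) {G : 𝓢(D, ℂ)}
    (hG : ∀ t, G t = ∫ z, γ z t ∂μ) (L : 𝓢(D, ℂ) →L[ℝ] ℝ) :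
    Integrable (fun z => L (γ z)) μ ∧ L G = ∫ z, L (γ z) ∂μ := by
  -- Continuity bounds L by finitely many seminorms, that is, by a norm in a Banach space. There L
  -- is represented by a functional Λ, and Λ commutes with the Bochner integral.
  obtain ⟨s, C, -, hC⟩ := Seminorm.bound_of_continuous (schwartz_withSeminorms ℝ D ℂ)
    ((normSeminorm ℝ ℝ).comp L.toLinearMap) (continuous_norm.comp L.continuous)
  obtain ⟨Λ, hΛ⟩ := exists_factorization
    (weightedDerivs s : 𝓢(D, ℂ) →L[ℝ] _).toLinearMap L.toLinearMap C
    fun f => (hC f).trans (mul_le_mul_of_nonneg_left (sup_seminorm_le_norm_weightedDerivs s f) C.2)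
  have hintι := integrable_weightedDerivs hγ hint s
  have hL := Λ.integrable_comp hintι
  have hL' := Λ.integral_comp_comm hintι
  rw [← weightedDerivs_eq_integral hγ hint hG] at hL'
  have e : ∀ f, Λ (weightedDerivs s f) = L f := hΛ
  simp only [e] at hL hL'
  exact ⟨hL, hL'.symm⟩

/-- Continuous functionals commute with weak integrals of Schwartz functions. -/
theorem integral_functional {γ : Z → 𝓢(D, ℂ)} (hγ : Continuous γ)
    (hint : ∀ k n, Integrable (fun z => SchwartzMap.seminorm ℝ k n (γ z)) μ) {G : 𝓢(D, ℂ)}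
    (hG : ∀ t, G t = ∫ z, γ z t ∂μ) (L : 𝓢(D, ℂ) →L[ℝ] ℂ) :
    Integrable (fun z => L (γ z)) μ ∧ L G = ∫ z, L (γ z) ∂μ := by
  obtain ⟨h1, h1'⟩ := integral_real_functional hγ hint hG (Complex.reCLM ∘L L)
  obtain ⟨h2, h2'⟩ := integral_real_functional hγ hint hG (Complex.imCLM ∘L L)
  have hi : Integrable (fun z => L (γ z)) μ := by
    have := (h1.ofReal (𝕜 := ℂ)).add ((h2.ofReal (𝕜 := ℂ)).mul_const Complex.I)
    refine this.congr (Filter.Eventually.of_forall fun z => ?_)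
    exact Complex.re_add_im (L (γ z))
  refine ⟨hi, ?_⟩
  rw [← integral_re_add_im hi]
  refine (Complex.re_add_im (L G)).symm.trans ?_
  exact congrArg₂ (fun a b : ℝ => (a : ℂ) + b * Complex.I) h1' h2'

end WeakIntegral

/-! ### Translations on the Schwartz space: growth and joint continuity. -/

section Translation
variable {D : Type} [NormedAddCommGroup D] [NormedSpace ℝ D]

theorem iteratedFDeriv_compSubConst (n : ℕ) (x : D) (f : 𝓢(D, ℂ)) (t : D) :
    iteratedFDeriv ℝ n (compSubConstCLM ℂ x f) t = iteratedFDeriv ℝ n f (t - x) :=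
  congrFun (iteratedFDeriv_comp_sub' (𝕜 := ℝ) (f := f) n x) t

theorem pow_norm_mul_iteratedFDeriv_sub_le (k n : ℕ) (f : 𝓢(D, ℂ)) (x t : D) :
    ‖t‖ ^ k * ‖iteratedFDeriv ℝ n f (t - x)‖ ≤ (1 + ‖x‖) ^ k *
      (2 ^ k * (Finset.Iic (k, n)).sup (schwartzSeminormFamily ℝ D ℂ) f) := by
  have h := one_add_le_sup_seminorm_apply (𝕜 := ℝ) (m := (k, n)) le_rfl le_rfl f (t - x)
  have ht : ‖t‖ ≤ (1 + ‖x‖) * (1 + ‖t - x‖) := by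
    have : ‖t‖ ≤ ‖t - x‖ + ‖x‖ := norm_le_norm_sub_add t x
    nlinarith [mul_nonneg (norm_nonneg x) (norm_nonneg (t - x))]
  calc ‖t‖ ^ k * ‖iteratedFDeriv ℝ n f (t - x)‖
      ≤ ((1 + ‖x‖) * (1 + ‖t - x‖)) ^ k * ‖iteratedFDeriv ℝ n f (t - x)‖ := by gcongr
    _ = (1 + ‖x‖) ^ k * ((1 + ‖t - x‖) ^ k * ‖iteratedFDeriv ℝ n f (t - x)‖) := by
        rw [mul_pow, mul_assoc]
    _ ≤ _ := mul_le_mul_of_nonneg_left h (by positivity)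

theorem seminorm_compSubConst_le (k n : ℕ) (f : 𝓢(D, ℂ)) (x : D) :
    SchwartzMap.seminorm ℝ k n (compSubConstCLM ℂ x f) ≤ (1 + ‖x‖) ^ k *
      (2 ^ k * (Finset.Iic (k, n)).sup (schwartzSeminormFamily ℝ D ℂ) f) := by
  refine seminorm_le_bound ℝ k n _ (by positivity) fun t => ?_
  rw [iteratedFDeriv_compSubConst]
  exact pow_norm_mul_iteratedFDeriv_sub_le k n f x t

/-- The mean value inequality in the translation parameter on a ball of radius R. It costs one
derivative, hence the order n + 1. -/
theorem seminorm_compSubConst_sub_le (k n : ℕ) (f : 𝓢(D, ℂ)) (x y : D) {R : ℝ}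
    (hx : ‖x‖ ≤ R) (hy : ‖y‖ ≤ R) :
    SchwartzMap.seminorm ℝ k n (compSubConstCLM ℂ x f - compSubConstCLM ℂ y f) ≤
      ((1 + R) ^ k * (2 ^ k * (Finset.Iic (k, n + 1)).sup (schwartzSeminormFamily ℝ D ℂ) f)) *
        ‖x - y‖ := by
  have hR : 0 ≤ R := (norm_nonneg x).trans hx
  refine seminorm_le_bound ℝ k n _ (by positivity) fun t => ?_
  have e : iteratedFDeriv ℝ n (compSubConstCLM ℂ x f - compSubConstCLM ℂ y f : 𝓢(D, ℂ)) t =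
      iteratedFDeriv ℝ n f (t - x) - iteratedFDeriv ℝ n f (t - y) := by
    rw [FunLike.coe_sub, iteratedFDeriv_sub_apply (SchwartzMap.smooth _ n).contDiffAt
      (SchwartzMap.smooth _ n).contDiffAt, iteratedFDeriv_compSubConst, iteratedFDeriv_compSubConst]
  rw [e]
  -- The available bound controls ‖t‖^k times the derivative, so the mean value inequality is used
  -- with a constant divided by ‖t‖^k.
  rcases eq_or_ne (‖t‖ ^ k) 0 with h0 | h0
  · rw [h0, zero_mul]; positivity
  have hpos : 0 < ‖t‖ ^ k := lt_of_le_of_ne (by positivity) h0.symm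
  have hmv := (convex_closedBall (0 : D) R).norm_image_sub_le_of_norm_hasFDerivWithin_le
    (f := fun x => iteratedFDeriv ℝ n f (t - x)) (𝕜 := ℝ)
    (f' := fun x => -(fderiv ℝ (iteratedFDeriv ℝ n f) (t - x)))
    (C := (‖t‖ ^ k)⁻¹ * ((1 + R) ^ k * (2 ^ k * (Finset.Iic (k, n + 1)).sup
      (schwartzSeminormFamily ℝ D ℂ) f))) (x := y) (y := x) ?_ ?_ (by simpa using hy)
      (by simpa using hx)
  · calc _ ≤ ‖t‖ ^ k * ((‖t‖ ^ k)⁻¹ * ((1 + R) ^ k * (2 ^ k * (Finset.Iic (k, n + 1)).sup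
      (schwartzSeminormFamily ℝ D ℂ) f)) * ‖x - y‖) := by gcongr
      _ = _ := by field_simp
  · intro z _
    have h1 : HasFDerivAt (iteratedFDeriv ℝ n f) (fderiv ℝ (iteratedFDeriv ℝ n f) (t - z))
      (t - z) := ((f.smooth (n + 1 : ℕ)).differentiable_iteratedFDeriv
        (by exact_mod_cast n.lt_succ_self) _).hasFDerivAt
    have h2 := h1.comp z ((hasFDerivAt_id z).const_sub t)
    refine (h2.congr_fderiv ?_).hasFDerivWithinAt
    ext; simp
  · intro z hz
    rw [norm_neg, norm_fderiv_iteratedFDeriv, ← div_eq_inv_mul, le_div_iff₀ hpos, mul_comm]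
    refine (pow_norm_mul_iteratedFDeriv_sub_le k (n + 1) f z t).trans ?_
    have : ‖z‖ ≤ R := by simpa using hz
    gcongr

theorem continuous_of_forall_seminorm {X : Type} [TopologicalSpace X] {F : X → 𝓢(D, ℂ)}
    (h : ∀ x₀ k n, Filter.Tendsto (fun x => SchwartzMap.seminorm ℝ k n (F x - F x₀))
      (nhds x₀) (nhds 0)) : Continuous F := by
  refine continuous_iff_continuousAt.2 fun x₀ => ?_
  refine ((schwartz_withSeminorms ℝ D ℂ).tendsto_nhds F (F x₀)).2 fun i ε hε => ?_
  exact (h x₀ i.1 i.2).eventually_lt_const hε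

theorem continuous_seminorm (k n : ℕ) : Continuous (SchwartzMap.seminorm ℝ k n : 𝓢(D, ℂ) → ℝ) :=
  (schwartz_withSeminorms ℝ D ℂ).continuous_seminorm (k, n)

theorem continuous_sup_seminorm (s : Finset (ℕ × ℕ)) :
    Continuous fun f : 𝓢(D, ℂ) => s.sup (schwartzSeminormFamily ℝ D ℂ) f :=
  Seminorm.continuous_finsetSup (s := s) (p := schwartzSeminormFamily ℝ D ℂ)
    fun i _ => (schwartz_withSeminorms ℝ D ℂ).continuous_seminorm i

/-- Translation is jointly continuous. -/
theorem continuous_compSubConst {X : Type} [TopologicalSpace X] {a : X → D} {F : X → 𝓢(D, ℂ)}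
    (ha : Continuous a) (hF : Continuous F) :
    Continuous fun x => compSubConstCLM ℂ (a x) (F x) := by
  refine continuous_of_forall_seminorm fun x₀ k n => ?_
  have h1 : Filter.Tendsto (fun x => (1 + ‖a x‖) ^ k * (2 ^ k * (Finset.Iic (k, n)).sup
      (schwartzSeminormFamily ℝ D ℂ) (F x - F x₀))) (nhds x₀) (nhds 0) := by
    have : Continuous (fun x => (1 + ‖a x‖) ^ k * (2 ^ k * (Finset.Iic (k, n)).sup
      (schwartzSeminormFamily ℝ D ℂ) (F x - F x₀))) :=
      ((continuous_const.add ha.norm).pow k).mul (continuous_const.mul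
        ((continuous_sup_seminorm _).comp (hF.sub continuous_const)))
    simpa using this.tendsto x₀
  set R := ‖a x₀‖ + 1
  have h2 : Filter.Tendsto (fun x => ((1 + R) ^ k * (2 ^ k * (Finset.Iic (k, n + 1)).sup
      (schwartzSeminormFamily ℝ D ℂ) (F x₀))) * ‖a x - a x₀‖) (nhds x₀) (nhds 0) := by
    have : Continuous (fun x => ((1 + R) ^ k * (2 ^ k * (Finset.Iic (k, n + 1)).sup
      (schwartzSeminormFamily ℝ D ℂ) (F x₀))) * ‖a x - a x₀‖) :=
      continuous_const.mul (ha.sub continuous_const).norm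
    simpa using this.tendsto x₀
  have hR : ∀ᶠ x in nhds x₀, ‖a x‖ ≤ R :=
    (ha.norm.tendsto x₀).eventually_le_const (by simp [R])
  refine tendsto_of_tendsto_of_tendsto_of_le_of_le' tendsto_const_nhds
    (by simpa using h1.add h2) (Filter.Eventually.of_forall fun x => apply_nonneg _ _) ?_
  filter_upwards [hR] with x hx
  -- The first summand is small since translations by bounded vectors are equicontinuous, the second
  -- by the mean value estimate for the fixed function F x₀.
  have e : compSubConstCLM ℂ (a x) (F x) - compSubConstCLM ℂ (a x₀) (F x₀) =
      compSubConstCLM ℂ (a x) (F x - F x₀) +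
        (compSubConstCLM ℂ (a x) (F x₀) - compSubConstCLM ℂ (a x₀) (F x₀)) := by
    rw [map_sub]; abel
  rw [e]
  refine (map_add_le_add _ _ _).trans (add_le_add (seminorm_compSubConst_le _ _ _ _) ?_)
  exact seminorm_compSubConst_sub_le k n (F x₀) (a x) (a x₀) hx (by simp [R])

theorem exists_sup_seminorm_compSubConst_le (s : Finset (ℕ × ℕ)) :
    ∃ (s' : Finset (ℕ × ℕ)) (N : ℕ) (C : ℝ), 0 ≤ C ∧ ∀ (x : D) (f : 𝓢(D, ℂ)),
      s.sup (schwartzSeminormFamily ℝ D ℂ) (compSubConstCLM ℂ x f) ≤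
        C * (1 + ‖x‖) ^ N * s'.sup (schwartzSeminormFamily ℝ D ℂ) f := by
  refine ⟨s.biUnion Finset.Iic, s.sup Prod.fst, 2 ^ s.sup Prod.fst, by positivity, fun x f => ?_⟩
  refine Seminorm.finset_sup_apply_le (by positivity) fun i hi => ?_
  refine (seminorm_compSubConst_le i.1 i.2 f x).trans ?_
  have h1 : i.1 ≤ s.sup Prod.fst := Finset.le_sup (f := Prod.fst) hi
  have h2 : (Finset.Iic i).sup (schwartzSeminormFamily ℝ D ℂ) f ≤
      (s.biUnion Finset.Iic).sup (schwartzSeminormFamily ℝ D ℂ) f :=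
    (Finset.sup_mono (f := schwartzSeminormFamily ℝ D ℂ) (Finset.subset_biUnion_of_mem _ hi)) f
  have h3 : (1 + ‖x‖) ^ i.1 ≤ (1 + ‖x‖) ^ s.sup Prod.fst :=
    pow_le_pow_right₀ (by linarith [norm_nonneg x]) h1
  have h4 : (2 : ℝ) ^ i.1 ≤ 2 ^ s.sup Prod.fst := pow_le_pow_right₀ one_le_two h1
  calc _ ≤ (1 + ‖x‖) ^ s.sup Prod.fst * (2 ^ s.sup Prod.fst *
      (s.biUnion Finset.Iic).sup (schwartzSeminormFamily ℝ D ℂ) f) := by gcongr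
    _ = _ := by ring

end Translation

/-! ### Time-frequency shifts as conjugated translations. -/

section Shift
variable {D : Type} [NormedAddCommGroup D] [InnerProductSpace ℝ D]

theorem tfShift_eq_modulation (x ω : D) (g : 𝓢(D, ℂ)) :
    tfShift x ω g = tfShift 0 ω (compSubConstCLM ℂ x g) := by
  ext t
  simp [tfShift_apply]

variable [FiniteDimensional ℝ D]
  [MeasurableSpace D] [BorelSpace D]

theorem fourier_modulation (ω : D) (g : 𝓢(D, ℂ)) :
    𝓕 (tfShift 0 ω g) = compSubConstCLM ℂ ω (𝓕 g) := by
  ext ξ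
  rw [compSubConstCLM_apply, fourier_coe, fourier_coe, Real.fourier_eq, Real.fourier_eq]
  refine integral_congr_ae (Filter.Eventually.of_forall fun t => ?_)
  simp only [tfShift_apply, Circle.smul_def, Real.fourierChar_apply, smul_eq_mul, sub_zero,
    ← mul_assoc, ← Complex.exp_add]
  congr 2
  rw [inner_sub_right, real_inner_comm ω t]
  push_cast
  ring

/-- Modulation is translation on the Fourier side. Continuity and seminorm growth of π(x, ω) thus
follow from those of translations, without differentiating the exponential. -/
theorem tfShift_eq (x ω : D) (g : 𝓢(D, ℂ)) :
    tfShift x ω g = 𝓕⁻ (compSubConstCLM ℂ ω (𝓕 (compSubConstCLM ℂ x g))) := by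
  rw [tfShift_eq_modulation, ← fourier_modulation, FourierPair.fourierInv_fourier_eq]

theorem continuous_tfShift (g : 𝓢(D, ℂ)) : Continuous fun z : D × D => tfShift z.1 z.2 g := by
  simp only [tfShift_eq]
  exact ContinuousFourierInv.continuous_fourierInv.comp (continuous_compSubConst continuous_snd
    (ContinuousFourier.continuous_fourier.comp
      (continuous_compSubConst continuous_fst continuous_const)))

/-- Seminorms are followed backwards through 𝓕⁻¹ T_ω 𝓕 T_x. The Fourier transforms cost constants,
and each translation costs a polynomial factor. -/
theorem exists_seminorm_tfShift_le (k n : ℕ) (f : 𝓢(D, ℂ)) :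
    ∃ (N : ℕ) (C : ℝ), 0 ≤ C ∧ ∀ (x ω : D),
      SchwartzMap.seminorm ℝ k n (tfShift x ω f) ≤ C * (1 + ‖x‖) ^ N * (1 + ‖ω‖) ^ N := by
  obtain ⟨s₁, C₁, hC₁, h₁⟩ := seminorm_comp_bound
    (((FourierTransform.fourierCLE ℂ 𝓢(D, ℂ)).symm : 𝓢(D, ℂ) →L[ℂ] 𝓢(D, ℂ)).restrictScalars ℝ) {(k, n)}
  obtain ⟨s₂, N₂, C₂, hC₂, h₂⟩ := exists_sup_seminorm_compSubConst_le (D := D) s₁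
  obtain ⟨s₃, C₃, hC₃, h₃⟩ := seminorm_comp_bound
    ((FourierTransform.fourierCLE ℂ 𝓢(D, ℂ) : 𝓢(D, ℂ) →L[ℂ] 𝓢(D, ℂ)).restrictScalars ℝ) s₂
  obtain ⟨s₄, N₄, C₄, hC₄, h₄⟩ := exists_sup_seminorm_compSubConst_le (D := D) s₃
  refine ⟨max N₂ N₄, C₁ * C₂ * C₃ * C₄ * s₄.sup (schwartzSeminormFamily ℝ D ℂ) f,
    by positivity, fun x ω => ?_⟩
  have hx : (1 + ‖x‖) ^ N₄ ≤ (1 + ‖x‖) ^ max N₂ N₄ :=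
    pow_le_pow_right₀ (by linarith [norm_nonneg x]) (le_max_right _ _)
  have hω : (1 + ‖ω‖) ^ N₂ ≤ (1 + ‖ω‖) ^ max N₂ N₄ :=
    pow_le_pow_right₀ (by linarith [norm_nonneg ω]) (le_max_left _ _)
  have e1 := h₁ (compSubConstCLM ℂ ω (𝓕 (compSubConstCLM ℂ x f)))
  have e2 := h₂ ω (𝓕 (compSubConstCLM ℂ x f))
  have e3 := h₃ (compSubConstCLM ℂ x f)
  have e4 := h₄ x f
  rw [Finset.sup_singleton] at e1
  rw [tfShift_eq]
  calc _ ≤ C₁ * _ := e1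
    _ ≤ C₁ * (C₂ * (1 + ‖ω‖) ^ N₂ * (C₃ * (C₄ * (1 + ‖x‖) ^ N₄ *
        s₄.sup (schwartzSeminormFamily ℝ D ℂ) f))) := by
      gcongr
      refine e2.trans ?_
      gcongr
      refine e3.trans ?_
      gcongr
    _ ≤ C₁ * (C₂ * (1 + ‖ω‖) ^ max N₂ N₄ * (C₃ * (C₄ * (1 + ‖x‖) ^ max N₂ N₄ *
        s₄.sup (schwartzSeminormFamily ℝ D ℂ) f))) := by gcongr
    _ = _ := by ring

end Shift

/-! ### The STFT: covariance, inversion and orthogonality. -/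

section STFT
variable {D : Type} [NormedAddCommGroup D] [InnerProductSpace ℝ D]

variable (D) in
/-- The linear change of variables `(x, t) ↦ (t, t - x)`. -/
def stftShear : (D × D) ≃L[ℝ] (D × D) :=
  ContinuousLinearEquiv.equivOfInverse
    ((ContinuousLinearMap.snd ℝ D D).prod
      (ContinuousLinearMap.snd ℝ D D - ContinuousLinearMap.fst ℝ D D))
    ((ContinuousLinearMap.fst ℝ D D - ContinuousLinearMap.snd ℝ D D).prod
      (ContinuousLinearMap.fst ℝ D D))
    (fun z => by ext <;> simp) (fun z => by ext <;> simp)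

theorem norm_exp_two_pi_I_inner (ω : D) (t : D) :
    ‖Complex.exp (2 * Real.pi * Complex.I * inner ℝ ω t)‖ = 1 := by
  have e : 2 * (Real.pi : ℂ) * Complex.I * inner ℝ ω t =
      ((2 * Real.pi * inner ℝ ω t : ℝ) : ℂ) * Complex.I := by push_cast; ring
  rw [e, Complex.norm_exp_ofReal_mul_I]

variable [FiniteDimensional ℝ D] [MeasurableSpace D] [BorelSpace D]

instance : (volume : Measure (D × D)).HasTemperateGrowth := by
  have : (volume : Measure (D × D)).IsAddHaarMeasure :=
    Measure.prod.instIsAddHaarMeasure volume volume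
  infer_instance

/-- The function `(x, t) ↦ f t * conj (Φ (t - x))`. -/
def stftKernel (Φ : 𝓢(D, ℂ)) : 𝓢(D, ℂ) →L[ℝ] 𝓢(D × D, ℂ) :=
  compCLMOfContinuousLinearEquiv ℝ (stftShear D) ∘L tensor (conjS Φ)

theorem stftKernel_apply (Φ f : 𝓢(D, ℂ)) (z : D × D) :
    stftKernel Φ f z = f z.2 * (starRingEnd ℂ) (Φ (z.2 - z.1)) := rfl

/-- The short-time Fourier transform of a Schwartz function, as a Schwartz function. -/
def stftS (Φ : 𝓢(D, ℂ)) : 𝓢(D, ℂ) →L[ℝ] 𝓢(D × D, ℂ) :=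
  partialFourier ∘L stftKernel Φ

theorem stftS_apply_eq_fourier (Φ f : 𝓢(D, ℂ)) (z : D × D) :
    stftS Φ f z = 𝓕 (slice (stftKernel Φ f) z.1) z.2 := rfl

theorem stftS_apply (Φ f : 𝓢(D, ℂ)) (z : D × D) :
    stftS Φ f z = ∫ t, f t * (starRingEnd ℂ) (tfShift z.1 z.2 Φ t) := by
  rw [stftS_apply_eq_fourier, fourier_coe, Real.fourier_eq]
  refine integral_congr_ae (Filter.Eventually.of_forall fun t => ?_)
  simp only [tfShift_apply, slice_apply, stftKernel_apply, Circle.smul_def,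
    Real.fourierChar_apply, smul_eq_mul, map_mul]
  have : (starRingEnd ℂ) (Complex.exp (2 * Real.pi * Complex.I * inner ℝ z.2 t)) =
      Complex.exp (((2 * Real.pi * -inner ℝ t z.2 : ℝ) : ℂ) * Complex.I) := by
    rw [← Complex.exp_conj]
    congr 1
    simp only [map_mul, Complex.conj_I, Complex.conj_ofReal, map_ofNat, real_inner_comm z.2 t]
    push_cast
    ring
  rw [this]
  ring

theorem stft_toTemperedDistribution (Φ f : 𝓢(D, ℂ)) (x ω : D) :
    stft Φ (toTemperedDistributionCLM D ℂ volume f) x ω = stftS Φ f (x, ω) := by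
  rw [stftS_apply]
  refine (toTemperedDistributionCLM_apply_apply volume f _).trans ?_
  refine integral_congr_ae (Filter.Eventually.of_forall fun t => ?_)
  simp only [conjS_apply, smul_eq_mul]
  ring

/-- The STFT of a time-frequency shift is, up to a phase, a translate of the STFT. -/
theorem norm_stftS_tfShift (Φ f : 𝓢(D, ℂ)) (x ω : D) (z : D × D) :
    ‖stftS Φ (tfShift x ω f) z‖ = ‖stftS Φ f (z.1 - x, z.2 - ω)‖ := by
  rw [stftS_apply, stftS_apply, ← integral_add_right_eq_self _ x]
  have e : ∀ t, tfShift x ω f (t + x) * (starRingEnd ℂ) (tfShift z.1 z.2 Φ (t + x)) =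
      Complex.exp (2 * Real.pi * Complex.I * inner ℝ (ω - z.2) x) *
        (f t * (starRingEnd ℂ) (tfShift (z.1 - x) (z.2 - ω) Φ t)) := fun t => by
    have a : t + x - z.1 = t - (z.1 - x) := by abel
    have b : ∀ ω t : D, (starRingEnd ℂ) (Complex.exp (2 * Real.pi * Complex.I * inner ℝ ω t)) =
        Complex.exp (-(2 * Real.pi * Complex.I * inner ℝ ω t)) := fun ω t => by
      rw [← Complex.exp_conj]
      simp only [map_mul, Complex.conj_I, Complex.conj_ofReal, map_ofNat]
      congr 1; ring
    simp only [tfShift_apply, map_mul, b, add_sub_cancel_right, a]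
    rw [mul_mul_mul_comm, ← Complex.exp_add, mul_left_comm (f t), ← mul_assoc (Complex.exp _)
      (Complex.exp _), ← Complex.exp_add]
    congr 2
    simp only [inner_sub_left, inner_add_right]
    push_cast
    ring
  simp only [e]
  rw [integral_const_mul, norm_mul, norm_exp_two_pi_I_inner, one_mul]

/-- The squared `L²` norm. -/
def normSq (φ : 𝓢(D, ℂ)) : ℝ := ∫ t, ‖φ t‖ ^ 2

theorem normSq_pos {φ : 𝓢(D, ℂ)} (hφ : φ ≠ 0) : 0 < normSq φ := by
  obtain ⟨t, ht⟩ : ∃ t, φ t ≠ 0 := by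
    by_contra! h
    exact hφ (SchwartzMap.ext h)
  have hi : Integrable fun t => ‖φ t‖ ^ 2 :=
    MemLp.integrable_norm_pow (p := 2) (φ.memLp _) two_ne_zero
  refine (integral_pos_iff_support_of_nonneg (fun _ => by positivity) hi).2 ?_
  refine IsOpen.measure_pos volume ?_ ⟨t, by simpa using ht⟩
  exact isOpen_ne_fun (φ.continuous.norm.pow 2) continuous_const

/-- The seminorms of π(z)φ grow polynomially in z while the STFT of f is a Schwartz function, so the
inversion integral converges absolutely in every seminorm. -/
theorem integrable_stftS_smul (Φ f : 𝓢(D, ℂ)) (φ : 𝓢(D, ℂ)) (k n : ℕ) :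
    Integrable (fun z : D × D => SchwartzMap.seminorm ℝ k n (stftS Φ f z • tfShift z.1 z.2 φ)) := by
  obtain ⟨N, C, hC, h⟩ := exists_seminorm_tfShift_le k n φ
  have hi : Integrable (fun z : D × D => (C * 2 ^ (2 * N)) * (‖stftS Φ f z‖ +
      ‖z‖ ^ (2 * N) * ‖stftS Φ f z‖)) :=
    ((stftS Φ f).integrable.norm.add ((stftS Φ f).integrable_pow_mul volume (2 * N))).const_mul _
  have hcont : Continuous fun z : D × D => stftS Φ f z • tfShift z.1 z.2 φ :=
    (stftS Φ f).continuous.smul (continuous_tfShift φ)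
  refine hi.mono' ((continuous_seminorm k n).comp hcont).aestronglyMeasurable
    (Filter.Eventually.of_forall fun z => ?_)
  rw [Real.norm_of_nonneg (apply_nonneg _ _)]
  have e : SchwartzMap.seminorm ℝ k n (stftS Φ f z • tfShift z.1 z.2 φ) =
      ‖stftS Φ f z‖ * SchwartzMap.seminorm ℝ k n (tfShift z.1 z.2 φ) := by
    have := map_smul_eq_mul (SchwartzMap.seminorm ℂ k n) (stftS Φ f z) (tfShift z.1 z.2 φ)
    exact this
  have h1 : 1 + ‖z.1‖ ≤ 1 + ‖z‖ := by gcongr; exact norm_fst_le z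
  have h2 : 1 + ‖z.2‖ ≤ 1 + ‖z‖ := by gcongr; exact norm_snd_le z
  have h3 : (1 + ‖z‖) ^ (2 * N) ≤ 2 ^ (2 * N) * (1 + ‖z‖ ^ (2 * N)) := by
    rcases le_total ‖z‖ 1 with h | h
    · calc (1 + ‖z‖) ^ (2 * N) ≤ 2 ^ (2 * N) := by gcongr; linarith
        _ ≤ _ := le_mul_of_one_le_right (by positivity) (by simp)
    · calc (1 + ‖z‖) ^ (2 * N) ≤ (2 * ‖z‖) ^ (2 * N) := by gcongr; linarith
        _ = 2 ^ (2 * N) * ‖z‖ ^ (2 * N) := mul_pow _ _ _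
        _ ≤ _ := by gcongr; linarith
  rw [e]
  calc _ ≤ ‖stftS Φ f z‖ * (C * (1 + ‖z.1‖) ^ N * (1 + ‖z.2‖) ^ N) := by gcongr; exact h _ _
    _ ≤ ‖stftS Φ f z‖ * (C * (1 + ‖z‖) ^ N * (1 + ‖z‖) ^ N) := by gcongr
    _ = ‖stftS Φ f z‖ * (C * (1 + ‖z‖) ^ (2 * N)) := by ring
    _ ≤ ‖stftS Φ f z‖ * (C * (2 ^ (2 * N) * (1 + ‖z‖ ^ (2 * N)))) := by gcongr
    _ = _ := by ring

/-- Pointwise inversion of the STFT. -/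
theorem integral_stftS_mul_tfShift (φ f : 𝓢(D, ℂ)) (t : D) :
    ∫ z : D × D, stftS φ f z * tfShift z.1 z.2 φ t = normSq φ * f t := by
  obtain ⟨C, hC⟩ : ∃ C, ∀ t, ‖φ t‖ ≤ C := ⟨_, φ.norm_le_seminorm ℝ⟩
  have hm : Continuous fun z : D × D => tfShift z.1 z.2 φ t := by
    simp only [tfShift_apply]
    fun_prop
  have hint : Integrable (fun z : D × D => stftS φ f z * tfShift z.1 z.2 φ t) := by
    refine ((stftS φ f).integrable.norm.mul_const C).mono'
      ((stftS φ f).continuous.mul hm).aestronglyMeasurable (Filter.Eventually.of_forall fun z => ?_)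
    rw [norm_mul, tfShift_apply, norm_mul, norm_exp_two_pi_I_inner, one_mul]
    gcongr
    exact hC _
  rw [Measure.volume_eq_prod, integral_prod _ hint]
  -- For fixed x the STFT is the Fourier transform of f · conj φ(· - x), so Fourier inversion
  -- evaluates the ω-integral. What is left for the x-integral is |φ(t - x)|².
  have inner_eq : ∀ x, ∫ ω, stftS φ f (x, ω) * tfShift x ω φ t =
      f t * (((‖φ (t - x)‖ ^ 2 : ℝ)) : ℂ) := fun x => by
    have h1 : slice (stftKernel φ f) x t = ∫ ω, Complex.exp (2 * Real.pi * Complex.I *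
        inner ℝ ω t) * stftS φ f (x, ω) := by
      rw [← FourierPair.fourierInv_fourier_eq (F := 𝓢(D, ℂ)) (slice (stftKernel φ f) x)]
      rw [fourierInv_coe, Real.fourierInv_eq]
      refine integral_congr_ae (Filter.Eventually.of_forall fun ω => ?_)
      simp only [Circle.smul_def, Real.fourierChar_apply, smul_eq_mul]
      rw [stftS_apply_eq_fourier]
      congr 2
      push_cast
      ring
    have h2 : ∫ ω, stftS φ f (x, ω) * tfShift x ω φ t =
        (∫ ω, Complex.exp (2 * Real.pi * Complex.I * inner ℝ ω t) * stftS φ f (x, ω)) *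
          φ (t - x) := by
      rw [← integral_mul_const]
      refine integral_congr_ae (Filter.Eventually.of_forall fun ω => ?_)
      simp only [tfShift_apply]
      ring
    rw [h2, ← h1, slice_apply, stftKernel_apply, mul_assoc, Complex.conj_mul']
    push_cast
    rfl
  simp only [inner_eq]
  rw [integral_const_mul, integral_complex_ofReal, normSq,
    integral_sub_left_eq_self (fun x => ‖φ x‖ ^ 2) volume t, mul_comm]

/-- Inversion of the STFT under a continuous real-linear functional. -/
theorem stftS_inversion (φ f : 𝓢(D, ℂ)) (L : 𝓢(D, ℂ) →L[ℝ] ℂ) :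
    Integrable (fun z : D × D => L (stftS φ f z • tfShift z.1 z.2 φ)) ∧
      ∫ z : D × D, L (stftS φ f z • tfShift z.1 z.2 φ) = normSq φ * L f := by
  have h := integral_functional (μ := (volume : Measure (D × D)))
    (γ := fun z => stftS φ f z • tfShift z.1 z.2 φ) (G := normSq φ • f)
    ((stftS φ f).continuous.smul (continuous_tfShift φ)) (integrable_stftS_smul φ f φ)
    (fun t => by
      rw [smul_apply, Complex.real_smul, ← integral_stftS_mul_tfShift]
      rfl) L
  refine ⟨h.1, ?_⟩
  rw [← h.2, map_smul, Complex.real_smul]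

/-- Orthogonality relations of the STFT, for a tempered distribution and a Schwartz function. -/
theorem stft_orthogonality (Φ g : 𝓢(D, ℂ)) (u : 𝓢'(D, ℂ)) :
    Integrable (fun z : D × D => stft Φ u z.1 z.2 * (starRingEnd ℂ) (stftS Φ g z)) ∧
      ∫ z : D × D, stft Φ u z.1 z.2 * (starRingEnd ℂ) (stftS Φ g z) = normSq Φ * sesq u g := by
  -- The functional g ↦ ⟨u, g⟩ is conjugate-linear, so inversion is needed for functionals that are
  -- merely real-linear.
  have h := stftS_inversion Φ g
    ((show 𝓢(D, ℂ) →L[ℂ] ℂ from u).restrictScalars ℝ ∘L conjS)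
  have e : ∀ z : D × D, ((show 𝓢(D, ℂ) →L[ℂ] ℂ from u).restrictScalars ℝ ∘L conjS)
      (stftS Φ g z • tfShift z.1 z.2 Φ) =
      stft Φ u z.1 z.2 * (starRingEnd ℂ) (stftS Φ g z) := fun z => by
    have : conjS (stftS Φ g z • tfShift z.1 z.2 Φ) =
        (starRingEnd ℂ) (stftS Φ g z) • conjS (tfShift z.1 z.2 Φ) := by
      ext t; simp [conjS_apply]
    change u (conjS (stftS Φ g z • tfShift z.1 z.2 Φ)) = _
    rw [this, map_smul, smul_eq_mul, mul_comm]
    rfl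
  simp only [e] at h
  exact h

theorem continuous_stft (Φ : 𝓢(D, ℂ)) (u : 𝓢'(D, ℂ)) :
    Continuous fun z : D × D => stft Φ u z.1 z.2 :=
  (show 𝓢(D, ℂ) →L[ℂ] ℂ from u).continuous.comp
    (conjS.continuous.comp (continuous_tfShift Φ))

end STFT

/-! ### Polynomial weights and decay factors. -/

section Weight
variable {D : Type} [NormedAddCommGroup D]

theorem weight_pos (s : ℝ) (z : D) : 0 < weight s z := by
  unfold weight; positivity

theorem one_le_weight {s : ℝ} (hs : 0 ≤ s) (z : D) : 1 ≤ weight s z :=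
  Real.one_le_rpow (by nlinarith [norm_nonneg z]) (by positivity)

theorem continuous_weight (s : ℝ) : Continuous (weight s : D → ℝ) := by
  unfold weight
  refine Continuous.rpow_const (by fun_prop) fun z => Or.inl ?_
  positivity

/-- From 1 + |x+y|² ≤ 2(1+|x|²)(1+|y|²). Submultiplicativity up to a constant lets L^1_{v_s} act on
weighted spaces by convolution. -/
theorem weight_add_le {s : ℝ} (hs : 0 ≤ s) (x y : D) :
    weight s (x + y) ≤ 2 ^ (s / 2) * (weight s x * weight s y) := by
  unfold weight
  rw [← Real.mul_rpow (by positivity) (by positivity), ← Real.mul_rpow (by positivity)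
    (by positivity)]
  refine Real.rpow_le_rpow (by positivity) ?_ (by positivity)
  have h := norm_add_le x y
  have h2 : ‖x + y‖ ^ 2 ≤ (‖x‖ + ‖y‖) ^ 2 := by gcongr
  nlinarith [sq_nonneg (‖x‖ - ‖y‖), mul_nonneg (sq_nonneg ‖x‖) (sq_nonneg ‖y‖)]

theorem weight_le_rpow {s : ℝ} (hs : 0 ≤ s) (x : D) : weight s x ≤ (1 + ‖x‖) ^ s := by
  have : (1 + ‖x‖) ^ s = ((1 + ‖x‖) ^ 2) ^ (s / 2) := by
    rw [← Real.rpow_natCast, ← Real.rpow_mul (by positivity)]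
    congr 1; push_cast; ring
  rw [weight, this]
  exact Real.rpow_le_rpow (by positivity) (by nlinarith [norm_nonneg x]) (by positivity)

theorem weight_le_of_norm_le {D' : Type} [NormedAddCommGroup D'] {s : ℝ}
    (hs : 0 ≤ s) {C : ℝ} (hC : 1 ≤ C) {x : D} {y : D'} (h : ‖x‖ ≤ C * ‖y‖) :
    weight s x ≤ (C ^ 2) ^ (s / 2) * weight s y := by
  unfold weight
  rw [← Real.mul_rpow (by positivity) (by positivity)]
  refine Real.rpow_le_rpow (by positivity) ?_ (by positivity)
  have h2 : ‖x‖ ^ 2 ≤ (C * ‖y‖) ^ 2 := by gcongr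
  nlinarith

/-- The decay factor `(1 + ‖x‖) ^ (-N)`. -/
def decayFactor (N : ℕ) (x : D) : ℝ≥0∞ := ENNReal.ofReal ((1 + ‖x‖) ^ (-(N : ℝ)))

theorem decayFactor_le_one (N : ℕ) (x : D) : decayFactor N x ≤ 1 :=
  ENNReal.ofReal_le_one.2 (Real.rpow_le_one_of_one_le_of_nonpos (by simp) (by simp))

theorem decayFactor_neg (N : ℕ) (x : D) : decayFactor N (-x) = decayFactor N x := by
  simp [decayFactor]

variable [MeasurableSpace D] [BorelSpace D]

theorem measurable_decayFactor (N : ℕ) : Measurable (decayFactor N : D → ℝ≥0∞) := by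
  unfold decayFactor
  fun_prop

variable [InnerProductSpace ℝ D] [FiniteDimensional ℝ D]

theorem lintegral_decayFactor_mul_weight_lt_top {s : ℝ} (hs : 0 ≤ s) {N : ℕ}
    (hN : s + Module.finrank ℝ D < N) :
    ∫⁻ x : D, decayFactor N x * ENNReal.ofReal (weight s x) < ⊤ := by
  have hi := integrable_one_add_norm (μ := (volume : Measure D)) (r := N - s) (by linarith)
  refine lt_of_le_of_lt (lintegral_mono fun x => ?_) hi.lintegral_lt_top
  rw [decayFactor, ← ENNReal.ofReal_mul (by positivity)]
  refine ENNReal.ofReal_le_ofReal ?_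
  calc _ ≤ (1 + ‖x‖) ^ (-(N : ℝ)) * (1 + ‖x‖) ^ s := by gcongr; exact weight_le_rpow hs x
    _ = _ := by rw [← Real.rpow_add (by positivity)]; congr 1; ring

theorem lintegral_decayFactor_lt_top {N : ℕ} (hN : Module.finrank ℝ D < N) :
    ∫⁻ x : D, decayFactor N x < ⊤ := by
  have h := lintegral_decayFactor_mul_weight_lt_top (D := D) le_rfl (N := N)
    (by rw [zero_add]; exact_mod_cast hN)
  simpa [weight] using h

end Weight

/-! ### Change of window in W(𝓕L^∞, L^1_{v_s}). -/

section Amalgam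
variable {D : Type} [NormedAddCommGroup D] [InnerProductSpace ℝ D]
  [FiniteDimensional ℝ D] [MeasurableSpace D] [BorelSpace D]

/-- The STFT of Schwartz functions decays, uniformly for bounded sets of functions. -/
theorem exists_norm_stftS_le (Φ : 𝓢(D, ℂ)) (N : ℕ) :
    ∃ (s : Finset (ℕ × ℕ)) (C : ℝ), 0 ≤ C ∧ ∀ (Ψ : 𝓢(D, ℂ)) (z : D × D),
      ‖stftS Φ Ψ z‖ₑ ≤ ENNReal.ofReal (C * s.sup (schwartzSeminormFamily ℝ D ℂ) Ψ) *
        (decayFactor N z.1 * decayFactor N z.2) := by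
  obtain ⟨s, C, hC, h⟩ := seminorm_comp_bound (stftS Φ) (Finset.Iic (2 * N, 0))
  refine ⟨s, 2 ^ (2 * N) * C, by positivity, fun Ψ z => ?_⟩
  have h0 := one_add_le_sup_seminorm_apply (𝕜 := ℝ) (m := (2 * N, 0)) le_rfl le_rfl (stftS Φ Ψ) z
  rw [norm_iteratedFDeriv_zero] at h0
  have h1 : (1 + ‖z.1‖) ^ N * (1 + ‖z.2‖) ^ N ≤ (1 + ‖z‖) ^ (2 * N) := by
    rw [two_mul, pow_add]
    gcongr
    · exact norm_fst_le z
    · exact norm_snd_le z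
  have h2 : ‖stftS Φ Ψ z‖ * ((1 + ‖z.1‖) ^ N * (1 + ‖z.2‖) ^ N) ≤
      2 ^ (2 * N) * C * s.sup (schwartzSeminormFamily ℝ D ℂ) Ψ := by
    calc _ ≤ ‖stftS Φ Ψ z‖ * (1 + ‖z‖) ^ (2 * N) := by gcongr
      _ = (1 + ‖z‖) ^ (2 * N) * ‖stftS Φ Ψ z‖ := mul_comm _ _
      _ ≤ 2 ^ (2 * N) * (C * s.sup (schwartzSeminormFamily ℝ D ℂ) Ψ) :=
        h0.trans (mul_le_mul_of_nonneg_left (h Ψ) (by positivity))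
      _ = _ := by ring
  rw [decayFactor, decayFactor, ← ENNReal.ofReal_mul (by positivity),
    ← ENNReal.ofReal_mul (by positivity), ← ofReal_norm]
  refine ENNReal.ofReal_le_ofReal ?_
  rw [Real.rpow_neg (by positivity), Real.rpow_neg (by positivity), Real.rpow_natCast,
    Real.rpow_natCast, ← mul_inv, ← div_eq_mul_inv, le_div_iff₀ (by positivity)]
  exact h2

/-- The supremum of the STFT over all frequencies. -/
def freqSup (Φ : 𝓢(D, ℂ)) (u : 𝓢'(D, ℂ)) (x : D) : ℝ≥0∞ := ⨆ ω, ‖stft Φ u x ω‖ₑ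

/-- The supremum is uncountable, but a supremum of continuous functions is lower semicontinuous. -/
theorem measurable_freqSup (Φ : 𝓢(D, ℂ)) (u : 𝓢'(D, ℂ)) : Measurable (freqSup Φ u) := by
  refine LowerSemicontinuous.measurable (lowerSemicontinuous_iSup fun ω => ?_)
  have hc : Continuous fun x => stft Φ u x ω :=
    Continuous.comp (g := fun z : D × D => stft Φ u z.1 z.2) (f := fun x => (x, ω))
      (continuous_stft Φ u) (by fun_prop)
  exact hc.enorm.lowerSemicontinuous

/-- The STFT is continuous, so the set where it is at most its essential supremum is closed. That
set has full measure, hence is dense, hence is everything. -/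
theorem freqSup_le_eLpNorm (Φ : 𝓢(D, ℂ)) (u : 𝓢'(D, ℂ)) (x : D) :
    freqSup Φ u x ≤ eLpNorm (fun ω => stft Φ u x ω) ∞ volume := by
  have hc : Continuous fun ω => stft Φ u x ω := Continuous.comp
    (g := fun z : D × D => stft Φ u z.1 z.2) (f := fun ω => (x, ω))
      (continuous_stft Φ u) (by fun_prop)
  have hae : ∀ᵐ ω : D, ‖stft Φ u x ω‖ₑ ≤ eLpNorm (fun ω => stft Φ u x ω) ∞ volume := by
    rw [eLpNorm_exponent_top]
    exact enorm_ae_le_eLpNormEssSup _ _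
  have hclosed : IsClosed {ω | ‖stft Φ u x ω‖ₑ ≤ eLpNorm (fun ω => stft Φ u x ω) ∞ volume} :=
    isClosed_le hc.enorm continuous_const
  have huniv := hclosed.closure_eq.symm.trans (Measure.dense_of_ae hae).closure_eq
  refine iSup_le fun ω => ?_
  have hω := Set.mem_univ ω
  rw [← huniv] at hω
  exact hω

/-- The convolution of `freqSup` with a decay factor. -/
def smoothedFreqSup (N : ℕ) (Φ : 𝓢(D, ℂ)) (u : 𝓢'(D, ℂ)) (x : D) : ℝ≥0∞ :=
  ∫⁻ y, freqSup Φ u y * decayFactor N (y - x)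

theorem measurable_smoothedFreqSup_integrand (N : ℕ) (Φ : 𝓢(D, ℂ)) (u : 𝓢'(D, ℂ)) :
    Measurable fun z : D × D => freqSup Φ u z.2 * decayFactor N (z.2 - z.1) :=
  ((measurable_freqSup Φ u).comp measurable_snd).mul
    ((measurable_decayFactor N).comp (measurable_snd.sub measurable_fst))

theorem measurable_smoothedFreqSup (N : ℕ) (Φ : 𝓢(D, ℂ)) (u : 𝓢'(D, ℂ)) :
    Measurable (smoothedFreqSup N Φ u) :=
  (measurable_smoothedFreqSup_integrand N Φ u).lintegral_prod_right'

theorem lintegral_freqSup_mul_decayFactor (N : ℕ) (Φ : 𝓢(D, ℂ)) (u : 𝓢'(D, ℂ)) (q : ℝ)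
    (x ω : D) :
    ∫⁻ z : D × D, (ENNReal.ofReal q * (freqSup Φ u z.1 * decayFactor N (z.1 - x))) *
      decayFactor N (z.2 - ω) =
    ENNReal.ofReal q * smoothedFreqSup N Φ u x * ∫⁻ η : D, decayFactor N η := by
  have m1 : Measurable fun y : D => ENNReal.ofReal q * (freqSup Φ u y * decayFactor N (y - x)) :=
    ((measurable_freqSup Φ u).mul ((measurable_decayFactor N).comp
      (measurable_id.sub_const x))).const_mul _
  have m2 : Measurable fun η : D => decayFactor N (η - ω) :=
    (measurable_decayFactor N).comp (measurable_id.sub_const ω)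
  rw [Measure.volume_eq_prod, lintegral_prod_mul m1.aemeasurable m2.aemeasurable,
    lintegral_sub_right_eq_self (fun η => decayFactor N η) ω,
    lintegral_const_mul' _ _ ENNReal.ofReal_ne_top]
  rfl

/-- The orthogonality relation for g = π(x, ω)Ψ, whose STFT is in modulus a translate of that of Ψ.
It dominates the STFT with window Ψ by a convolution-type integral of the STFT with window Φ. -/
theorem normSq_mul_enorm_stft_le (Φ Ψ : 𝓢(D, ℂ)) (u : 𝓢'(D, ℂ)) (x ω : D) :
    ENNReal.ofReal (normSq Φ) * ‖stft Ψ u x ω‖ₑ ≤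
      ∫⁻ z : D × D, ‖stft Φ u z.1 z.2‖ₑ * ‖stftS Φ Ψ (z.1 - x, z.2 - ω)‖ₑ := by
  have h1 : ∫ z : D × D, stft Φ u z.1 z.2 * (starRingEnd ℂ) (stftS Φ (tfShift x ω Ψ) z) =
      normSq Φ * stft Ψ u x ω := (stft_orthogonality Φ (tfShift x ω Ψ) u).2
  have hn : 0 ≤ normSq Φ := integral_nonneg fun _ => by positivity
  have h2 : ENNReal.ofReal (normSq Φ) * ‖stft Ψ u x ω‖ₑ = ‖(normSq Φ : ℂ) * stft Ψ u x ω‖ₑ := by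
    rw [enorm_mul, ← ofReal_norm (normSq Φ : ℂ), Complex.norm_real, Real.norm_of_nonneg hn]
  rw [h2, ← h1]
  refine (enorm_integral_le_lintegral_enorm _).trans_eq (lintegral_congr fun z => ?_)
  rw [enorm_mul, ← ofReal_norm ((starRingEnd ℂ) _), RCLike.norm_conj, norm_stftS_tfShift,
    ofReal_norm]

/-- Change of window. -/
theorem exists_enorm_stft_le {Φ : 𝓢(D, ℂ)} (hΦ : Φ ≠ 0) (u : 𝓢'(D, ℂ)) {N : ℕ}
    (hN : Module.finrank ℝ D < N) :
    ∃ (s : Finset (ℕ × ℕ)) (C : ℝ), 0 ≤ C ∧ ∀ (Ψ : 𝓢(D, ℂ)) (x ω : D),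
      ‖stft Ψ u x ω‖ₑ ≤ ENNReal.ofReal (C * s.sup (schwartzSeminormFamily ℝ D ℂ) Ψ) *
        smoothedFreqSup N Φ u x := by
  obtain ⟨s, C, hC, h⟩ := exists_norm_stftS_le Φ N
  have hA := lintegral_decayFactor_lt_top (D := D) hN
  have hn := normSq_pos hΦ
  refine ⟨s, (normSq Φ)⁻¹ * (∫⁻ x : D, decayFactor N x).toReal * C, by positivity,
    fun Ψ x ω => ?_⟩
  have hq : 0 ≤ s.sup (schwartzSeminormFamily ℝ D ℂ) Ψ := apply_nonneg _ _
  generalize hqd : s.sup (schwartzSeminormFamily ℝ D ℂ) Ψ = q at hq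
  have h2 : ENNReal.ofReal (normSq Φ) * ‖stft Ψ u x ω‖ₑ ≤
      ENNReal.ofReal (C * q) * smoothedFreqSup N Φ u x * ∫⁻ η : D, decayFactor N η := by
    rw [← lintegral_freqSup_mul_decayFactor N Φ u (C * q) x ω]
    -- Once the STFT of u is replaced by its supremum over frequencies, the frequency variable
    -- survives only in a decay factor and integrates to a constant independent of ω.
    refine (normSq_mul_enorm_stft_le Φ Ψ u x ω).trans (lintegral_mono fun z => ?_)
    calc _ ≤ freqSup Φ u z.1 * (ENNReal.ofReal (C * q) *
        (decayFactor N (z.1 - x) * decayFactor N (z.2 - ω))) :=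
          mul_le_mul' (le_iSup (fun ω => ‖stft Φ u z.1 ω‖ₑ) z.2) (hqd ▸ h Ψ _)
      _ = _ := by ring
  generalize (∫⁻ η : D, decayFactor N η) = A at hA h2
  have h3 : ENNReal.ofReal ((normSq Φ)⁻¹ * A.toReal * C * q) =
      (ENNReal.ofReal (normSq Φ))⁻¹ * (ENNReal.ofReal (C * q) * A) := by
    rw [mul_assoc, ENNReal.ofReal_mul (by positivity), ENNReal.ofReal_mul (by positivity),
      ENNReal.ofReal_inv_of_pos hn, ENNReal.ofReal_toReal hA.ne]
    ring
  have hn0 : ENNReal.ofReal (normSq Φ) ≠ 0 := by simpa using hn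
  rw [h3, mul_assoc, ← ENNReal.div_eq_inv_mul, ENNReal.le_div_iff_mul_le (Or.inl hn0)
    (Or.inl ENNReal.ofReal_ne_top), mul_comm, mul_assoc, mul_comm A, ← mul_assoc]
  exact h2

/-- Young's inequality L^1_{v_s} * L^1_{v_s} ⊂ L^1_{v_s}, by Tonelli and submultiplicativity of v_s.
The condition on N puts the decay factor in L^1_{v_s}. -/
theorem lintegral_smoothedFreqSup_lt_top (Φ : 𝓢(D, ℂ)) (u : 𝓢'(D, ℂ)) {s : ℝ} (hs : 0 ≤ s)
    {N : ℕ} (hN : s + Module.finrank ℝ D < N)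
    (hu : ∫⁻ x, freqSup Φ u x * ENNReal.ofReal (weight s x) < ⊤) :
    ∫⁻ x, smoothedFreqSup N Φ u x * ENNReal.ofReal (weight s x) < ⊤ := by
  have hmw : Measurable fun x : D => ENNReal.ofReal (weight s x) :=
    (continuous_weight s).measurable.ennreal_ofReal
  have hB := lintegral_decayFactor_mul_weight_lt_top (D := D) hs hN
  set B := ∫⁻ x : D, decayFactor N x * ENNReal.ofReal (weight s x) with hBdef
  calc ∫⁻ x, smoothedFreqSup N Φ u x * ENNReal.ofReal (weight s x)
      = ∫⁻ x, ∫⁻ y, freqSup Φ u y * decayFactor N (y - x) * ENNReal.ofReal (weight s x) := by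
        refine lintegral_congr fun x => ?_
        rw [smoothedFreqSup, lintegral_mul_const' _ _ ENNReal.ofReal_ne_top]
    _ = ∫⁻ y, ∫⁻ x, freqSup Φ u y * decayFactor N (y - x) * ENNReal.ofReal (weight s x) := by
        refine lintegral_lintegral_swap (Measurable.aemeasurable ?_)
        exact (measurable_smoothedFreqSup_integrand N Φ u).mul (hmw.comp measurable_fst)
    _ ≤ ∫⁻ y, ∫⁻ x, (ENNReal.ofReal (2 ^ (s / 2)) * (freqSup Φ u y * ENNReal.ofReal (weight s y))) *
          (decayFactor N (x - y) * ENNReal.ofReal (weight s (x - y))) := by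
        refine lintegral_mono fun y => lintegral_mono fun x => ?_
        have h1 := weight_add_le hs y (x - y)
        rw [add_sub_cancel] at h1
        rw [← decayFactor_neg, neg_sub]
        calc _ ≤ freqSup Φ u y * decayFactor N (x - y) * ENNReal.ofReal
              (2 ^ (s / 2) * (weight s y * weight s (x - y))) := by gcongr
          _ = _ := by
            rw [ENNReal.ofReal_mul (by positivity), ENNReal.ofReal_mul (weight_pos s y).le]
            ring
    _ = ∫⁻ y, (ENNReal.ofReal (2 ^ (s / 2)) * (freqSup Φ u y * ENNReal.ofReal (weight s y))) * B := by
        refine lintegral_congr fun y => ?_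
        have m : Measurable fun x : D =>
            decayFactor N (x - y) * ENNReal.ofReal (weight s (x - y)) :=
          ((measurable_decayFactor N).mul hmw).comp (measurable_id.sub_const y)
        rw [lintegral_const_mul _ m, lintegral_sub_right_eq_self
          (fun x => decayFactor N x * ENNReal.ofReal (weight s x)) y]
    _ = ENNReal.ofReal (2 ^ (s / 2)) * (∫⁻ y, freqSup Φ u y * ENNReal.ofReal (weight s y)) * B := by
        rw [lintegral_mul_const' _ _ hB.ne, lintegral_const_mul' _ _ ENNReal.ofReal_ne_top]
    _ < ⊤ := ENNReal.mul_lt_top (ENNReal.mul_lt_top ENNReal.ofReal_lt_top hu) hB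

/-- For `u` in the amalgam space `W(𝓕 L^∞, L^1_{v_s})`, the STFT with an arbitrary window is
dominated, uniformly in the frequency, by a function in `L^1_{v_s}`. -/
theorem exists_majorant {Φ : 𝓢(D, ℂ)} (hΦ : Φ ≠ 0) (u : 𝓢'(D, ℂ)) {s : ℝ} (hs : 0 ≤ s)
    (hu : ∫⁻ x, freqSup Φ u x * ENNReal.ofReal (weight s x) < ⊤) :
    ∃ H : D → ℝ, (∀ x, 0 ≤ H x) ∧ Measurable H ∧ Integrable (fun x => H x * weight s x) ∧
      ∃ (S : Finset (ℕ × ℕ)) (C : ℝ), 0 ≤ C ∧ ∀ (Ψ : 𝓢(D, ℂ)) (x ω : D),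
        ‖stft Ψ u x ω‖ ≤ C * S.sup (schwartzSeminormFamily ℝ D ℂ) Ψ * H x := by
  obtain ⟨N, hN⟩ := exists_nat_gt (s + Module.finrank ℝ D)
  have hN' : Module.finrank ℝ D < N := by
    have : (Module.finrank ℝ D : ℝ) < N := by linarith
    exact_mod_cast this
  obtain ⟨S, C, hC, h⟩ := exists_enorm_stft_le hΦ u hN'
  -- Since the decay factor is at most 1 and the weight at least 1, the hypothesis on u bounds the
  -- convolution at every point, not only almost everywhere.
  have hfin : ∀ x, smoothedFreqSup N Φ u x ≠ ⊤ := fun x => by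
    refine (lt_of_le_of_lt (lintegral_mono fun y => ?_) hu).ne
    exact mul_le_mul' le_rfl ((decayFactor_le_one N _).trans
      (ENNReal.one_le_ofReal.2 (one_le_weight hs y)))
  have hm := (measurable_smoothedFreqSup N Φ u).ennreal_toReal
  refine ⟨fun x => (smoothedFreqSup N Φ u x).toReal, fun x => ENNReal.toReal_nonneg, hm, ?_,
    S, C, hC, fun Ψ x ω => ?_⟩
  · refine ⟨(hm.mul (continuous_weight s).measurable).aestronglyMeasurable, ?_⟩
    refine lt_of_le_of_lt (lintegral_mono fun x => ?_) (lintegral_smoothedFreqSup_lt_top Φ u hs hN hu)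
    rw [← ofReal_norm, Real.norm_of_nonneg (mul_nonneg ENNReal.toReal_nonneg (weight_pos s x).le),
      ENNReal.ofReal_mul ENNReal.toReal_nonneg, ENNReal.ofReal_toReal (hfin x)]
  · have h1 := h Ψ x ω
    rw [← ofReal_norm, ← ENNReal.ofReal_toReal (hfin x), ← ENNReal.ofReal_mul (by positivity)] at h1
    exact (ENNReal.ofReal_le_ofReal_iff (by positivity)).1 h1

end Amalgam

/-- The hypothesis on the symbol, as a bound on the supremum of the STFT. -/
theorem lintegral_freqSup_lt_top {d : ℕ} {Φ : 𝓢(Phase d, ℂ)} {u : 𝓢'(Phase d, ℂ)}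
    {w : Phase d → ℝ} (hu : u ∈ wienerAmalgam Φ ∞ 1 (fun _ => 1) w) :
    ∫⁻ x, freqSup Φ u x * ENNReal.ofReal (w x) < ⊤ := by
  have h : amalgamNorm Φ ∞ 1 (fun _ => 1) w u < ⊤ := hu
  rw [amalgamNorm, eLpNorm_one_eq_lintegral_enorm] at h
  refine lt_of_le_of_lt (lintegral_mono fun x => ?_) h
  rw [enorm_eq_self]
  simp only [Complex.ofReal_one, mul_one]
  exact mul_le_mul' (freqSup_le_eLpNorm Φ u x) le_rfl

/-! ### Covariance of the τ-Wigner distribution. -/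

section Covariance
variable {d : ℕ}

/-- The point `(x, ω)` of phase space. -/
def phasePoint (x ω : Space d) : Phase d := (EuclideanSpace.sumEquivProd (𝕜 := ℝ)).symm (x, ω)

@[simp] theorem pos_phasePoint (x ω : Space d) : pos (phasePoint x ω) = x := by
  simp [pos, phasePoint]

@[simp] theorem freq_phasePoint (x ω : Space d) : freq (phasePoint x ω) = ω := by
  simp [freq, phasePoint]

theorem phase_ext {z w : Phase d} (h1 : pos z = pos w) (h2 : freq z = freq w) : z = w := by
  ext i
  rcases i with i | i
  · exact congrArg (fun v : Space d => v i) h1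
  · exact congrArg (fun v : Space d => v i) h2

@[simp] theorem pos_sub (z w : Phase d) : pos (z - w) = pos z - pos w := rfl
@[simp] theorem freq_sub (z w : Phase d) : freq (z - w) = freq z - freq w := rfl

theorem inner_phase (z w : Phase d) :
    inner ℝ z w = inner ℝ (pos z) (pos w) + inner ℝ (freq z) (freq w) := by
  simp only [PiLp.inner_apply, Fintype.sum_sum_type]
  rfl

/-- The linear map `(x, ω) ↦ (a x, b ω)`. -/
def phaseScale {a b : ℝ} (ha : a ≠ 0) (hb : b ≠ 0) : Phase d ≃L[ℝ] Phase d :=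
  ((EuclideanSpace.sumEquivProd (𝕜 := ℝ)).trans
    ((ContinuousLinearEquiv.smulLeft (R₁ := ℝ) (Units.mk0 a ha)).prodCongr
      (ContinuousLinearEquiv.smulLeft (R₁ := ℝ) (Units.mk0 b hb)))).trans
    (EuclideanSpace.sumEquivProd (𝕜 := ℝ)).symm

theorem pos_phaseScale {a b : ℝ} (ha : a ≠ 0) (hb : b ≠ 0) (z : Phase d) :
    pos (phaseScale ha hb z) = a • pos z := by
  change pos (phasePoint (a • pos z) (b • freq z)) = _
  simp

theorem freq_phaseScale {a b : ℝ} (ha : a ≠ 0) (hb : b ≠ 0) (z : Phase d) :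
    freq (phaseScale ha hb z) = b • freq z := by
  change freq (phasePoint (a • pos z) (b • freq z)) = _
  simp

theorem pos_tauMatrix (τ : ℝ) (z : Phase d) :
    pos (Matrix.toEuclideanCLM (𝕜 := ℝ) (tauMatrix d τ) z) = -((τ / (1 - τ)) • pos z) := by
  ext i
  rw [pos_apply]
  change (tauMatrix d τ).mulVec z.ofLp (Sum.inl i) = _
  have : z.ofLp = Sum.elim (pos z).ofLp (freq z).ofLp := by
    funext j; rcases j with j | j <;> rfl
  rw [this, tauMatrix, Matrix.neg_mulVec, Matrix.fromBlocks_mulVec]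
  simp [Matrix.smul_mulVec]

theorem freq_tauMatrix (τ : ℝ) (z : Phase d) :
    freq (Matrix.toEuclideanCLM (𝕜 := ℝ) (tauMatrix d τ) z) = -(((1 - τ) / τ) • freq z) := by
  ext i
  rw [freq_apply]
  change (tauMatrix d τ).mulVec z.ofLp (Sum.inr i) = _
  have : z.ofLp = Sum.elim (pos z).ofLp (freq z).ofLp := by
    funext j; rcases j with j | j <;> rfl
  rw [this, tauMatrix, Matrix.neg_mulVec, Matrix.fromBlocks_mulVec]
  simp [Matrix.smul_mulVec]

/-- The position of the `τ`-Wigner distribution of two time-frequency shifts. -/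
def wignerCenter (τ : ℝ) (w z : Phase d) : Phase d :=
  phasePoint ((1 - τ) • pos w + τ • pos z) (τ • freq w + (1 - τ) • freq z)

/-- The frequency of the `τ`-Wigner distribution of two time-frequency shifts. -/
def wignerFreq (w z : Phase d) : Phase d :=
  phasePoint (freq w - freq z) (-(pos w - pos z))

/-- Covariance of the `τ`-Wigner distribution under time-frequency shifts. -/
theorem wigner_phaseShift (τ : ℝ) (f g : 𝓢(Space d, ℂ)) (w z : Phase d) :
    wigner τ (phaseShift w g) (phaseShift z f) =
      Complex.exp (2 * Real.pi * Complex.I *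
        inner ℝ (pos w - pos z) (τ • freq w + (1 - τ) • freq z)) •
      tfShift (wignerCenter τ w z) (wignerFreq w z) (wigner τ g f) := by
  have b : ∀ ω t : Space d, (starRingEnd ℂ) (Complex.exp (2 * Real.pi * Complex.I * inner ℝ ω t)) =
      Complex.exp (-(2 * Real.pi * Complex.I * inner ℝ ω t)) := fun ω t => by
    rw [← Complex.exp_conj]
    simp only [map_mul, Complex.conj_I, Complex.conj_ofReal, map_ofNat]
    congr 1; ring
  ext u
  -- Translating y by the difference of the two positions makes both arguments depend on u only
  -- through u minus the centre. The rest is a comparison of phases.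
  rw [smul_apply, tfShift_apply, wigner_apply, wigner_apply, smul_eq_mul, ← mul_assoc,
    ← integral_const_mul, ← integral_add_right_eq_self _ (pos w - pos z)]
  refine integral_congr_ae (Filter.Eventually.of_forall fun y => ?_)
  have e1 : pos u + τ • (y + (pos w - pos z)) - pos w =
      pos (u - wignerCenter τ w z) + τ • y := by
    simp only [pos_sub, wignerCenter, pos_phasePoint]; module
  have e2 : pos u - (1 - τ) • (y + (pos w - pos z)) - pos z =
      pos (u - wignerCenter τ w z) - (1 - τ) • y := by
    simp only [pos_sub, wignerCenter, pos_phasePoint]; module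
  simp only [phaseShift, tfShift_apply, e1, e2, map_mul, b]
  rw [mul_mul_mul_comm, ← Complex.exp_add, ← mul_assoc (Complex.exp _) (Complex.exp _),
    ← Complex.exp_add, ← Complex.exp_add, ← mul_assoc (Complex.exp _) (Complex.exp _),
    ← Complex.exp_add]
  congr 2
  rw [inner_phase]
  simp only [wignerFreq, wignerCenter, pos_phasePoint, freq_phasePoint, freq_sub, inner_add_left,
    inner_add_right, inner_sub_left, inner_sub_right, inner_neg_left,
    inner_smul_right]
  rw [real_inner_comm y (freq w), real_inner_comm y (freq z), real_inner_comm (pos w) (freq w),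
    real_inner_comm (pos w) (freq z), real_inner_comm (pos z) (freq w),
    real_inner_comm (pos z) (freq z)]
  push_cast
  ring

/-- Links the Gabor matrix of the operator to the STFT of its symbol, the quantity that the amalgam
norm controls. -/
theorem norm_sesq_opTau_phaseShift (τ : ℝ) (σ : 𝓢'(Phase d, ℂ)) (f g : 𝓢(Space d, ℂ))
    (w z : Phase d) : ‖sesq (opTau τ σ (phaseShift z f)) (phaseShift w g)‖ =
      ‖stft (wigner τ g f) σ (wignerCenter τ w z) (wignerFreq w z)‖ := by
  rw [sesq_opTau, wigner_phaseShift]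
  have h : ∀ (c : ℂ) (h : 𝓢(Phase d, ℂ)), conjS (c • h) = (starRingEnd ℂ) c • conjS h :=
    fun c h => by ext t; simp [conjS_apply]
  rw [sesq, h, map_smul, smul_eq_mul, norm_mul, RCLike.norm_conj, norm_exp_two_pi_I_inner, one_mul]
  rfl

/-- The substitution y ↦ -y. It moves f into the linear slot, so f ↦ Op_τ(σ)f tested on a fixed
function is visibly a continuous functional. -/
theorem conjS_wigner (τ : ℝ) (f g : 𝓢(Space d, ℂ)) :
    conjS (wigner τ g f) = wigner (1 - τ) f g := by
  ext u
  rw [conjS_apply, wigner_apply, wigner_apply, ← integral_conj, ← integral_neg_eq_self]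
  refine integral_congr_ae (Filter.Eventually.of_forall fun y => ?_)
  have b : (starRingEnd ℂ) (Complex.exp (-2 * Real.pi * Complex.I * inner ℝ (-y) (freq u))) =
      Complex.exp (-2 * Real.pi * Complex.I * inner ℝ y (freq u)) := by
    rw [← Complex.exp_conj]
    simp only [map_mul, map_neg, Complex.conj_I, Complex.conj_ofReal, map_ofNat, inner_neg_left]
    congr 1; push_cast; ring
  have e1 : pos u + τ • -y = pos u - (1 - (1 - τ)) • y := by module
  have e2 : pos u - (1 - τ) • -y = pos u + (1 - τ) • y := by module
  simp only [map_mul, b, Complex.conj_conj, e1, e2]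
  ring

/-- The `τ`-Wigner distribution as a continuous linear map of its first argument. -/
def wignerLeft (τ : ℝ) (g : 𝓢(Space d, ℂ)) : 𝓢(Space d, ℂ) →L[ℝ] 𝓢(Phase d, ℂ) :=
  compCLMOfContinuousLinearEquiv ℝ (EuclideanSpace.sumEquivProd (𝕜 := ℝ)) ∘L partialFourier ∘L
    compCLMOfContinuousLinearEquiv ℝ (shear (Space d) τ) ∘L tensor (conjS g)

/-- The functional `f ↦ ⟨Op_τ(σ) f, ψ⟩` (bilinear pairing). -/
def opTauFunctional (τ : ℝ) (σ : 𝓢'(Phase d, ℂ)) (ψ : 𝓢(Space d, ℂ)) : 𝓢(Space d, ℂ) →L[ℝ] ℂ :=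
  (show 𝓢(Phase d, ℂ) →L[ℂ] ℂ from σ).restrictScalars ℝ ∘L wignerLeft (1 - τ) (conjS ψ)

theorem opTauFunctional_apply (τ : ℝ) (σ : 𝓢'(Phase d, ℂ)) (ψ f : 𝓢(Space d, ℂ)) :
    opTauFunctional τ σ ψ f = opTau τ σ f ψ := by
  change σ (wigner (1 - τ) f (conjS ψ)) = σ (conjS (wigner τ (conjS ψ) f))
  rw [conjS_wigner]

/-- Factoring 1 - τ out of the position and τ out of the frequency leaves w - U_τ z: the origin of
the matrix U_τ. -/
theorem wignerCenter_eq {τ : ℝ} (h0 : τ ≠ 0) (h1 : 1 - τ ≠ 0) (w z : Phase d) :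
    wignerCenter τ w z =
      phaseScale h1 h0 (w - Matrix.toEuclideanCLM (𝕜 := ℝ) (tauMatrix d τ) z) := by
  refine phase_ext ?_ ?_
  · rw [pos_phaseScale, pos_sub, pos_tauMatrix, wignerCenter, pos_phasePoint, sub_neg_eq_add,
      smul_add, smul_smul, mul_div_cancel₀ _ h1]
  · rw [freq_phaseScale, freq_sub, freq_tauMatrix, wignerCenter, freq_phasePoint, sub_neg_eq_add,
      smul_add, smul_smul, mul_div_cancel₀ _ h0]

/-- At w = 0 the centre is still an invertible function of z, so Op_τ(σ)π(z)f tested on a fixed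
function is integrable in z. -/
theorem wignerCenter_zero {τ : ℝ} (h0 : τ ≠ 0) (h1 : 1 - τ ≠ 0) (z : Phase d) :
    wignerCenter τ 0 z = phaseScale h0 h1 z := by
  have p0 : pos (0 : Phase d) = 0 := rfl
  have f0 : freq (0 : Phase d) = 0 := rfl
  refine phase_ext ?_ ?_
  · rw [pos_phaseScale, wignerCenter, pos_phasePoint, p0, smul_zero, zero_add]
  · rw [freq_phaseScale, wignerCenter, freq_phasePoint, f0, smul_zero, zero_add]

theorem phaseShift_zero (g : 𝓢(Space d, ℂ)) : phaseShift 0 g = g := by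
  have p0 : pos (0 : Phase d) = 0 := rfl
  have f0 : freq (0 : Phase d) = 0 := rfl
  ext t
  simp [phaseShift, tfShift_apply, p0, f0]

end Covariance

/-! ### Linear changes of variables in L^1_{v_s}. -/

section LinearChange
variable {E : Type} [NormedAddCommGroup E] [InnerProductSpace ℝ E]

theorem exists_weight_le_comp_linearEquiv {s : ℝ} (hs : 0 ≤ s) (L : E ≃L[ℝ] E) :
    ∃ C : ℝ, 0 ≤ C ∧ ∀ x, weight s x ≤ C * weight s (L x) := by
  refine ⟨((max 1 ‖(L.symm : E →L[ℝ] E)‖) ^ 2) ^ (s / 2), by positivity, fun x => ?_⟩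
  refine weight_le_of_norm_le hs (le_max_left _ _) ?_
  calc ‖x‖ = ‖(L.symm : E →L[ℝ] E) (L x)‖ := by simp
    _ ≤ ‖(L.symm : E →L[ℝ] E)‖ * ‖L x‖ := ContinuousLinearMap.le_opNorm _ _
    _ ≤ _ := by gcongr; exact le_max_right _ _

variable [FiniteDimensional ℝ E] [MeasurableSpace E] [BorelSpace E]

theorem integrable_comp_linearEquiv {f : E → ℝ} (hf : Integrable f) (L : E ≃L[ℝ] E) :
    Integrable fun x => f (L x) := by
  have hdet : LinearMap.det (L : E →ₗ[ℝ] E) ≠ 0 := (LinearEquiv.isUnit_det' L.toLinearEquiv).ne_zero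
  have h := Measure.map_linearMap_addHaar_eq_smul_addHaar (volume : Measure E) hdet
  have h2 : Integrable f (Measure.map L volume) := by
    have h' : Measure.map L (volume : Measure E) = _ := h
    rw [h']
    exact hf.smul_measure ENNReal.ofReal_ne_top
  exact h2.comp_measurable L.continuous.measurable

theorem integrable_comp_linearEquiv_mul_weight {s : ℝ} (hs : 0 ≤ s) {H : E → ℝ}
    (hH : Measurable H) (hi : Integrable fun x => H x * weight s x) (L : E ≃L[ℝ] E) :
    Integrable fun x => H (L x) * weight s x := by
  obtain ⟨C, hC, h⟩ := exists_weight_le_comp_linearEquiv hs L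
  refine ((integrable_comp_linearEquiv hi L).norm.const_mul C).mono'
    ((hH.comp L.continuous.measurable).mul (continuous_weight s).measurable).aestronglyMeasurable
    (Filter.Eventually.of_forall fun x => ?_)
  rw [norm_mul, norm_mul, Real.norm_of_nonneg (weight_pos s x).le,
    Real.norm_of_nonneg (weight_pos s (L x)).le]
  calc _ ≤ ‖H (L x)‖ * (C * weight s (L x)) := by gcongr; exact h x
    _ = _ := by ring

end LinearChange

/-! ### Bounds on the Gabor matrix of Op_τ(σ), and part (i). -/

section Operator
variable {d : ℕ}

/-- Kernel bounds for `Op_τ(σ)`, `σ` in the amalgam space. -/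
theorem exists_kernel_bound {τ : ℝ} (h0 : τ ≠ 0) (h1 : 1 - τ ≠ 0) {s : ℝ} (hs : 0 ≤ s)
    {Φ : 𝓢(Phase d, ℂ)} (hΦ : Φ ≠ 0) {σ : 𝓢'(Phase d, ℂ)}
    (hσ : σ ∈ wienerAmalgam Φ ∞ 1 (fun _ => 1) (weight s)) :
    ∃ H G : Phase d → ℝ, (∀ z, 0 ≤ H z) ∧ Measurable H ∧
      Integrable (fun z => H z * weight s z) ∧ (∀ z, 0 ≤ G z) ∧ Integrable G ∧
      (∀ f g : 𝓢(Space d, ℂ), ∃ C : ℝ, 0 ≤ C ∧ ∀ w z : Phase d,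
        ‖sesq (opTau τ σ (phaseShift z f)) (phaseShift w g)‖ ≤
          C * H (w - Matrix.toEuclideanCLM (𝕜 := ℝ) (tauMatrix d τ) z)) ∧
      (∀ f : 𝓢(Space d, ℂ), ∃ (S : Finset (ℕ × ℕ)) (C : ℝ), 0 ≤ C ∧
        ∀ (ψ : 𝓢(Space d, ℂ)) (z : Phase d), ‖opTau τ σ (phaseShift z f) ψ‖ ≤
          C * S.sup (schwartzSeminormFamily ℝ (Space d) ℂ) ψ * G z) := by
  obtain ⟨H, hH0, hHm, hHi, S, C, hC, hb⟩ := exists_majorant hΦ σ hs (lintegral_freqSup_lt_top hσ)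
  -- The dilation diag(1-τ, τ) carries w - U_τ z to the centre, and diag(τ, 1-τ) carries z to the
  -- centre for w = 0.
  refine ⟨fun z => H (phaseScale h1 h0 z), fun z => H (phaseScale h0 h1 z), fun z => hH0 _,
    hHm.comp (phaseScale h1 h0).continuous.measurable,
    integrable_comp_linearEquiv_mul_weight hs hHm hHi _, fun z => hH0 _, ?_, fun f g => ?_,
    fun f => ?_⟩
  · refine integrable_comp_linearEquiv (hHi.norm.mono' hHm.aestronglyMeasurable
      (Filter.Eventually.of_forall fun x => ?_)) _
    rw [norm_mul, Real.norm_of_nonneg (weight_pos s x).le]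
    exact le_mul_of_one_le_right (norm_nonneg _) (one_le_weight hs x)
  · refine ⟨C * S.sup (schwartzSeminormFamily ℝ (Phase d) ℂ) (wigner τ g f), by positivity,
      fun w z => ?_⟩
    rw [norm_sesq_opTau_phaseShift]
    exact (hb _ _ _).trans_eq (by rw [wignerCenter_eq h0 h1])
  -- The window W_τ(conj ψ, f) depends continuously on ψ, which turns the window-dependent constant
  -- into a Schwartz seminorm of ψ.
  · obtain ⟨S', C', hC', h'⟩ := seminorm_comp_bound (wignerLeft τ f ∘L conjS) S
    refine ⟨S', C * C', by positivity, fun ψ z => ?_⟩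
    have e : ‖opTau τ σ (phaseShift z f) ψ‖ =
        ‖sesq (opTau τ σ (phaseShift z f)) (phaseShift 0 (conjS ψ))‖ := by
      have hc : conjS (conjS ψ) = ψ := by ext x; simp [conjS_apply]
      rw [phaseShift_zero, sesq, hc]
    rw [e, norm_sesq_opTau_phaseShift, wignerCenter_zero h0 h1]
    refine (hb _ _ _).trans ?_
    rw [mul_assoc C C']
    have := hH0 (phaseScale h0 h1 z)
    gcongr
    exact h' ψ

theorem opTau_mem_generalizedMetaplectic {τ : ℝ} (hτ0 : 0 < τ) (hτ1 : τ < 1) {s : ℝ} (hs : 0 ≤ s)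
    {Φ : 𝓢(Phase d, ℂ)} (hΦ : Φ ≠ 0) {σ : 𝓢'(Phase d, ℂ)}
    (hσ : σ ∈ wienerAmalgam Φ ∞ 1 (fun _ => 1) (weight s)) (g : 𝓢(Space d, ℂ)) :
    opTau τ σ ∈ generalizedMetaplectic g ⟨tauMatrix d τ, tauMatrix_mem hτ0.ne' hτ1.ne⟩ s := by
  obtain ⟨H, G, -, -, hHi, -, -, hb, -⟩ :=
    exists_kernel_bound hτ0.ne' (sub_ne_zero.2 hτ1.ne') hs hΦ hσ
  obtain ⟨C, hC, h⟩ := hb g g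
  refine ⟨fun z => C * H z, ?_, h⟩
  simpa only [mul_assoc] using hHi.const_mul C

end Operator

/-! ### Schur's test on L^p. -/

section Schur
variable {X : Type} [MeasurableSpace X] {μ : Measure X} [SFinite μ]

/-- Schur's test. -/
theorem eLpNorm_le_of_schur {k : X → X → ℝ≥0∞} (hk : Measurable (Function.uncurry k))
    {M : ℝ≥0∞} (hM : M ≠ ⊤) (h1 : ∀ w, ∫⁻ z, k w z ∂μ ≤ M) (h2 : ∀ z, ∫⁻ w, k w z ∂μ ≤ M)
    {F G : X → ℂ} (hF : Measurable F) (hG : ∀ w, ‖G w‖ₑ ≤ ∫⁻ z, k w z * ‖F z‖ₑ ∂μ)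
    {p : ℝ≥0∞} (hp : 1 ≤ p) : eLpNorm G p μ ≤ M * eLpNorm F p μ := by
  have hkw : ∀ w, Measurable (k w) := fun w => hk.of_uncurry_left
  -- Hölder for the measure k(w, ·)μ, whose mass is at most M. For p = ∞ the convention `p.toReal =
  -- 0` makes the exponent of M equal to 1, as it should be.
  have hν : ∀ w, ‖G w‖ₑ ≤ eLpNorm F p (μ.withDensity (k w)) * M ^ (1 - 1 / p.toReal) := fun w => by
    have huniv : μ.withDensity (k w) Set.univ ≤ M := by
      rw [withDensity_apply _ MeasurableSet.univ, Measure.restrict_univ]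
      exact h1 w
    have hexp : 0 ≤ 1 - 1 / p.toReal := by
      rcases eq_or_ne p ⊤ with rfl | hp'
      · simp
      · have : 1 ≤ p.toReal := by
          rw [← ENNReal.toReal_one]; exact ENNReal.toReal_mono hp' hp
        rw [sub_nonneg, div_le_one (by linarith)]
        exact this
    have e : ∫⁻ z, k w z * ‖F z‖ₑ ∂μ = eLpNorm F 1 (μ.withDensity (k w)) := by
      rw [eLpNorm_one_eq_lintegral_enorm, lintegral_withDensity_eq_lintegral_mul _ (hkw w) hF.enorm]
      rfl
    refine ((hG w).trans_eq e).trans ((eLpNorm_le_eLpNorm_mul_rpow_measure_univ hp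
      hF.aestronglyMeasurable).trans ?_)
    rw [ENNReal.toReal_one, div_one]
    gcongr
  rcases eq_or_ne p ⊤ with rfl | hp'
  · simp only [ENNReal.toReal_top, div_zero, sub_zero, ENNReal.rpow_one] at hν
    rw [eLpNorm_exponent_top]
    refine eLpNormEssSup_le_of_ae_enorm_bound (Filter.Eventually.of_forall fun w => ?_)
    refine (hν w).trans ?_
    rw [mul_comm, eLpNorm_exponent_top, eLpNorm_exponent_top]
    exact mul_le_mul' le_rfl (eLpNormEssSup_mono_measure F (withDensity_absolutelyContinuous μ _))
  have hp0 : p ≠ 0 := (zero_lt_one.trans_le hp).ne'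
  set r := p.toReal with hr
  have hr1 : 1 ≤ r := by
    rw [← ENNReal.toReal_one]; exact ENNReal.toReal_mono hp' hp
  have hr0 : 0 < r := by linarith
  have hpow : ∀ w, ‖G w‖ₑ ^ r ≤ M ^ (r - 1) * ∫⁻ z, k w z * ‖F z‖ₑ ^ r ∂μ := fun w => by
    refine (ENNReal.rpow_le_rpow (hν w) hr0.le).trans ?_
    rw [ENNReal.mul_rpow_of_nonneg _ _ hr0.le, ← ENNReal.rpow_mul,
      eLpNorm_eq_lintegral_rpow_enorm_toReal hp0 hp', ← ENNReal.rpow_mul, ← hr,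
      one_div, inv_mul_cancel₀ hr0.ne', ENNReal.rpow_one,
      lintegral_withDensity_eq_lintegral_mul _ (hkw w) (hF.enorm.pow_const r), mul_comm]
    refine mul_le_mul' (le_of_eq ?_) le_rfl
    congr 1
    field_simp
  have hFr : Measurable fun z => ‖F z‖ₑ ^ r := hF.enorm.pow_const r
  have hint : ∫⁻ w, ‖G w‖ₑ ^ r ∂μ ≤ M ^ r * ∫⁻ z, ‖F z‖ₑ ^ r ∂μ := by
    calc ∫⁻ w, ‖G w‖ₑ ^ r ∂μ ≤ ∫⁻ w, M ^ (r - 1) * ∫⁻ z, k w z * ‖F z‖ₑ ^ r ∂μ ∂μ :=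
          lintegral_mono hpow
      _ = M ^ (r - 1) * ∫⁻ w, ∫⁻ z, k w z * ‖F z‖ₑ ^ r ∂μ ∂μ :=
          lintegral_const_mul' _ _ (ENNReal.rpow_ne_top_of_nonneg (by linarith) hM)
      _ = M ^ (r - 1) * ∫⁻ z, ∫⁻ w, k w z * ‖F z‖ₑ ^ r ∂μ ∂μ := by
          rw [lintegral_lintegral_swap (hk.mul (hFr.comp measurable_snd)).aemeasurable]
      _ = M ^ (r - 1) * ∫⁻ z, (∫⁻ w, k w z ∂μ) * ‖F z‖ₑ ^ r ∂μ := by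
          congr 1
          exact lintegral_congr fun z => lintegral_mul_const _ hk.of_uncurry_right
      _ ≤ M ^ (r - 1) * ∫⁻ z, M * ‖F z‖ₑ ^ r ∂μ := by
          gcongr with z; exact h2 z
      _ = M ^ r * ∫⁻ z, ‖F z‖ₑ ^ r ∂μ := by
          rw [lintegral_const_mul' _ _ hM, ← mul_assoc]
          congr 1
          -- Adding the exponents r - 1 and 1 requires M ≠ 0.
          rcases eq_or_ne M 0 with rfl | hM0
          · rw [mul_zero, ENNReal.zero_rpow_of_pos hr0]
          · nth_rewrite 2 [← ENNReal.rpow_one M]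
            rw [← ENNReal.rpow_add _ _ hM0 hM, sub_add_cancel]
  rw [eLpNorm_eq_lintegral_rpow_enorm_toReal hp0 hp', eLpNorm_eq_lintegral_rpow_enorm_toReal hp0 hp',
    ← hr]
  refine (ENNReal.rpow_le_rpow hint (by positivity)).trans_eq ?_
  rw [ENNReal.mul_rpow_of_nonneg _ _ (by positivity), ← ENNReal.rpow_mul, mul_one_div_cancel hr0.ne',
    ENNReal.rpow_one]

end Schur

/-! ### The STFT on phase space; modulation spaces between 𝓢 and M^∞. -/

section PhaseSpace
variable {d : ℕ}

/-- Phase space splits, with its measure, into positions and frequencies. -/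
theorem measurePreserving_pos_freq :
    MeasurePreserving (fun z : Phase d => (pos z, freq z)) volume volume := by
  have h1 := PiLp.volume_preserving_ofLp (Fin d ⊕ Fin d)
  have h2 := volume_measurePreserving_sumPiEquivProdPi (fun _ : Fin d ⊕ Fin d => ℝ)
  have h3 := (PiLp.volume_preserving_toLp (Fin d)).prod (PiLp.volume_preserving_toLp (Fin d))
  exact h3.comp (h2.comp h1)

theorem measurableEmbedding_pos_freq :
    MeasurableEmbedding fun z : Phase d => (pos z, freq z) :=
  (EuclideanSpace.sumEquivProd (𝕜 := ℝ) (ι := Fin d) (κ := Fin d)).toHomeomorph.measurableEmbedding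

theorem continuous_pos_freq : Continuous fun z : Phase d => (pos z, freq z) :=
  (EuclideanSpace.sumEquivProd (𝕜 := ℝ) (ι := Fin d) (κ := Fin d)).continuous

/-- The STFT as a function on phase space. -/
def phaseSTFT (φ : 𝓢(Space d, ℂ)) (f : 𝓢'(Space d, ℂ)) (z : Phase d) : ℂ :=
  stft φ f (pos z) (freq z)

theorem weightedSTFT_eq (φ : 𝓢(Space d, ℂ)) (m : Phase d → ℝ) (f : 𝓢'(Space d, ℂ)) (z : Phase d) :
    weightedSTFT φ m f z = phaseSTFT φ f z * m z := rfl

theorem continuous_phaseSTFT (φ : 𝓢(Space d, ℂ)) (f : 𝓢'(Space d, ℂ)) :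
    Continuous (phaseSTFT φ f) :=
  Continuous.comp (g := fun z : Space d × Space d => stft φ f z.1 z.2) (continuous_stft φ f)
    continuous_pos_freq

/-- The STFT of a Schwartz function, as a Schwartz function on phase space. -/
def phaseSTFTS (φ f : 𝓢(Space d, ℂ)) : 𝓢(Phase d, ℂ) :=
  compCLMOfContinuousLinearEquiv ℝ (EuclideanSpace.sumEquivProd (𝕜 := ℝ)) (stftS φ f)

theorem phaseSTFTS_apply (φ f : 𝓢(Space d, ℂ)) (z : Phase d) :
    phaseSTFTS φ f z = stftS φ f (pos z, freq z) := rfl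

theorem phaseSTFT_toTemperedDistribution (φ f : 𝓢(Space d, ℂ)) (z : Phase d) :
    phaseSTFT φ (toTemperedDistributionCLM (Space d) ℂ volume f) z = phaseSTFTS φ f z :=
  stft_toTemperedDistribution φ f (pos z) (freq z)

theorem integral_comp_pos_freq {V : Type} [NormedAddCommGroup V] [NormedSpace ℝ V]
    (f : Space d × Space d → V) : ∫ z : Phase d, f (pos z, freq z) = ∫ z, f z :=
  measurePreserving_pos_freq.integral_comp measurableEmbedding_pos_freq f

theorem lintegral_comp_pos_freq (f : Space d × Space d → ℝ≥0∞) :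
    ∫⁻ z : Phase d, f (pos z, freq z) = ∫⁻ z, f z :=
  measurePreserving_pos_freq.lintegral_comp_emb measurableEmbedding_pos_freq f

/-- Inversion of the STFT on phase space. -/
theorem integral_phaseSTFTS_smul (φ f : 𝓢(Space d, ℂ)) (L : 𝓢(Space d, ℂ) →L[ℝ] ℂ) :
    ∫ z : Phase d, L (phaseSTFTS φ f z • phaseShift z φ) = normSq φ * L f := by
  have h := integral_comp_pos_freq
    (fun z : Space d × Space d => L (stftS φ f z • tfShift z.1 z.2 φ))
  have h2 := (stftS_inversion φ f L).2
  rw [← h2, ← h]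
  simp only [phaseSTFTS_apply, phaseShift]

/-- The reproducing inequality with equal windows, transported to phase space. Its kernel V_φ φ is a
Schwartz function. -/
theorem normSq_mul_enorm_phaseSTFT_le (φ : 𝓢(Space d, ℂ)) (f : 𝓢'(Space d, ℂ)) (z₀ : Phase d) :
    ENNReal.ofReal (normSq φ) * ‖phaseSTFT φ f z₀‖ₑ ≤
      ∫⁻ z : Phase d, ‖phaseSTFT φ f z‖ₑ * ‖phaseSTFTS φ φ (z - z₀)‖ₑ := by
  have h := lintegral_comp_pos_freq (fun z : Space d × Space d =>
    ‖stft φ f z.1 z.2‖ₑ * ‖stftS φ φ (z.1 - pos z₀, z.2 - freq z₀)‖ₑ)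
  have h2 := normSq_mul_enorm_stft_le φ φ f (pos z₀) (freq z₀)
  have h3 : ∀ z : Phase d, (pos z - pos z₀, freq z - freq z₀) = (pos (z - z₀), freq (z - z₀)) :=
    fun _ => rfl
  simp only [h3] at h
  simp only [phaseSTFT, phaseSTFTS_apply]
  rw [h]
  refine h2.trans (lintegral_mono fun z => ?_)
  refine mul_le_mul' le_rfl (le_of_eq ?_)
  exact congrArg (fun w => ‖stftS φ φ w‖ₑ) rfl

theorem lintegral_enorm_mul_comp_sub_le {p q : ℝ≥0∞} [p.HolderTriple q 1] {F K : Phase d → ℂ}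
    (hF : Continuous F) (hK : Continuous K) (z₀ : Phase d) :
    ∫⁻ z : Phase d, ‖F z‖ₑ * ‖K (z - z₀)‖ₑ ≤ eLpNorm F p volume * eLpNorm K q volume := by
  have hmp := measurePreserving_sub_right (volume : Measure (Phase d)) z₀
  have h := eLpNorm_smul_le_mul_eLpNorm (μ := (volume : Measure (Phase d))) (p := p) (q := q)
    (r := 1) (f := K ∘ fun z => z - z₀) (φ := F)
    (hK.comp (continuous_id.sub continuous_const)).aestronglyMeasurable hF.aestronglyMeasurable
  rw [eLpNorm_comp_measurePreserving hK.aestronglyMeasurable hmp,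
    eLpNorm_one_eq_lintegral_enorm] at h
  refine le_trans (le_of_eq (lintegral_congr fun z => ?_)) h
  rw [← enorm_mul]
  rfl

theorem eLpNorm_phaseSTFT_le (φ : 𝓢(Space d, ℂ)) (p : ℝ≥0∞) {s : ℝ} (hs : 0 ≤ s)
    (f : 𝓢'(Space d, ℂ)) :
    eLpNorm (phaseSTFT φ f) p volume ≤ modulationNorm φ p (weight s) f := by
  refine eLpNorm_mono fun z => ?_
  rw [weightedSTFT_eq, norm_mul, Complex.norm_real, Real.norm_of_nonneg (weight_pos s z).le]
  exact le_mul_of_one_le_right (norm_nonneg _) (one_le_weight hs z)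

/-- `M^p_{v_s}` embeds into `M^∞`. -/
theorem exists_enorm_phaseSTFT_le {φ : 𝓢(Space d, ℂ)} (hφ : φ ≠ 0) {p : ℝ≥0∞} (hp : 1 ≤ p) {s : ℝ}
    (hs : 0 ≤ s) : ∃ B : ℝ≥0∞, B ≠ ⊤ ∧ ∀ (f : 𝓢'(Space d, ℂ)) (z : Phase d),
      ‖phaseSTFT φ f z‖ₑ ≤ B * modulationNorm φ p (weight s) f := by
  have hn := normSq_pos hφ
  have hpq : p.HolderTriple (ENNReal.conjExponent p) 1 := ENNReal.HolderConjugate.conjExponent hp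
  have hK : MemLp (phaseSTFTS φ φ) (ENNReal.conjExponent p) volume :=
    SchwartzMap.memLp _ _ volume
  have hKc := (phaseSTFTS φ φ).continuous
  have hb := normSq_mul_enorm_phaseSTFT_le φ
  generalize (phaseSTFTS φ φ : Phase d → ℂ) = K at hK hKc hb
  generalize normSq φ = n at hn hb
  have hn0 : ENNReal.ofReal n ≠ 0 := by simpa using hn
  refine ⟨(ENNReal.ofReal n)⁻¹ * eLpNorm K (ENNReal.conjExponent p) volume,
    ENNReal.mul_ne_top (ENNReal.inv_ne_top.2 hn0) hK.2.ne, fun f z₀ => ?_⟩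
  -- Hölder with V_φ φ in the conjugate L^q. Translation invariance makes the bound independent of
  -- the point.
  have h4 := (hb f z₀).trans ((lintegral_enorm_mul_comp_sub_le
    (q := ENNReal.conjExponent p) (continuous_phaseSTFT φ f) hKc
    z₀).trans (mul_le_mul' (eLpNorm_phaseSTFT_le φ p hs f) le_rfl))
  rw [mul_assoc, ← ENNReal.div_eq_inv_mul, ENNReal.le_div_iff_mul_le (Or.inl hn0)
    (Or.inl ENNReal.ofReal_ne_top), mul_comm]
  rwa [mul_comm (eLpNorm _ _ _)]

/-- The Schwartz space is contained in `M^p_{v_s}`. -/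
theorem toTemperedDistribution_mem_modulationSpace (φ f : 𝓢(Space d, ℂ)) (p : ℝ≥0∞) (s : ℝ) :
    toTemperedDistributionCLM (Space d) ℂ volume f ∈ modulationSpace φ p (weight s) := by
  have hg : Function.HasTemperateGrowth fun z : Phase d => (1 + ‖z‖ ^ 2) ^ (s / 2) :=
    Function.hasTemperateGrowth_one_add_norm_sq_rpow (Phase d) (s / 2)
  have e : weightedSTFT φ (weight s) (toTemperedDistributionCLM (Space d) ℂ volume f) =
      smulLeftCLM (𝕜 := ℝ) ℂ (fun z : Phase d => (1 + ‖z‖ ^ 2) ^ (s / 2)) (phaseSTFTS φ f) := by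
    funext z
    rw [smulLeftCLM_apply_apply hg, weightedSTFT_eq, phaseSTFT_toTemperedDistribution,
      Complex.real_smul, mul_comm]
    rfl
  change MemLp (weightedSTFT φ (weight s) (toTemperedDistributionCLM (Space d) ℂ volume f)) p volume
  rw [e]
  exact SchwartzMap.memLp _ p volume

end PhaseSpace

/-! ### Weak superpositions of tempered distributions. -/

section Superposition
variable {d : ℕ}

theorem sup_schwartzSeminormFamily_eq (S : Finset (ℕ × ℕ)) (ψ : 𝓢(Space d, ℂ)) :
    S.sup (schwartzSeminormFamily ℝ (Space d) ℂ) ψ =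
      S.sup (schwartzSeminormFamily ℂ (Space d) ℂ) ψ := by
  rw [Seminorm.finset_sup_apply, Seminorm.finset_sup_apply]
  rfl

/-- The superposition `∫ F(z) K(z) dz` of a family of tempered distributions. -/
theorem exists_superposition {K : Phase d → 𝓢'(Space d, ℂ)} {G : Phase d → ℝ}
    (hK : ∀ ψ, Continuous fun z => K z ψ) (hG : Integrable G)
    {S : Finset (ℕ × ℕ)} {C : ℝ} (hC : 0 ≤ C) (hG0 : ∀ z, 0 ≤ G z)
    (hb : ∀ (ψ : 𝓢(Space d, ℂ)) (z : Phase d),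
      ‖K z ψ‖ ≤ C * S.sup (schwartzSeminormFamily ℝ (Space d) ℂ) ψ * G z)
    {F : Phase d → ℂ} (hF : Continuous F) {B : ℝ} (hB : ∀ z, ‖F z‖ ≤ B) :
    ∃ u : 𝓢'(Space d, ℂ), ∀ ψ, Integrable (fun z => F z * K z ψ) ∧ u ψ = ∫ z, F z * K z ψ := by
  have hB0 : 0 ≤ B := (norm_nonneg _).trans (hB 0)
  have hle : ∀ (ψ : 𝓢(Space d, ℂ)) z, ‖F z * K z ψ‖ ≤
      B * (C * S.sup (schwartzSeminormFamily ℝ (Space d) ℂ) ψ) * G z := fun ψ z => by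
    rw [norm_mul, mul_assoc]
    exact mul_le_mul (hB z) (hb ψ z) (norm_nonneg _) hB0
  have hi : ∀ ψ : 𝓢(Space d, ℂ), Integrable fun z => F z * K z ψ := fun ψ =>
    (hG.const_mul _).mono' (hF.mul (hK ψ)).aestronglyMeasurable
      (Filter.Eventually.of_forall (hle ψ))
  refine ⟨ContinuousLinearMap.toPointwiseConvergenceCLM _ _ _ _
    (mkCLMtoNormedSpace (σ := RingHom.id ℂ) (fun ψ => ∫ z, F z * K z ψ) (fun ψ₁ ψ₂ => ?_)
      (fun c ψ => ?_) ⟨S, B * C * ∫ z, G z, ?_, fun ψ => ?_⟩), fun ψ => ⟨hi ψ, rfl⟩⟩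
  · rw [← integral_add (hi ψ₁) (hi ψ₂)]
    exact integral_congr_ae (Filter.Eventually.of_forall fun z => by
      simp only [map_add, mul_add])
  · rw [RingHom.id_apply, smul_eq_mul, ← integral_const_mul]
    exact integral_congr_ae (Filter.Eventually.of_forall fun z => by
      simp only [map_smul, smul_eq_mul]; ring)
  · exact mul_nonneg (mul_nonneg hB0 hC) (integral_nonneg hG0)
  · refine (norm_integral_le_of_norm_le (hG.const_mul _)
      (Filter.Eventually.of_forall (hle ψ))).trans_eq ?_
    rw [integral_const_mul, sup_schwartzSeminormFamily_eq]
    ring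

end Superposition

/-! ### Modulation norms of superpositions. -/

section Boundedness
variable {d : ℕ}

theorem norm_phaseSTFT_le_toReal {φ : 𝓢(Space d, ℂ)} {p : ℝ≥0∞} {s : ℝ} {B : ℝ≥0∞}
    (hB : B ≠ ⊤) {f : 𝓢'(Space d, ℂ)}
    (h : ∀ z : Phase d, ‖phaseSTFT φ f z‖ₑ ≤ B * modulationNorm φ p (weight s) f) {N : ℝ≥0∞}
    (hN : N ≠ ⊤) (hfN : modulationNorm φ p (weight s) f ≤ N) (z : Phase d) :
    ‖phaseSTFT φ f z‖ ≤ (B * N).toReal := by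
  rw [← toReal_enorm]
  exact ENNReal.toReal_mono (ENNReal.mul_ne_top hB hN) ((h z).trans (mul_le_mul' le_rfl hfN))

/-- The pointwise kernel bound on the STFT of a superposition. -/
theorem enorm_weightedSTFT_le_of_kernel {φ : 𝓢(Space d, ℂ)} {s : ℝ} (hs : 0 ≤ s)
    {K : Phase d → 𝓢'(Space d, ℂ)} {U : Phase d ≃L[ℝ] Phase d} {H : Phase d → ℝ}
    (hH0 : ∀ z, 0 ≤ H z) {A : ℝ} (hA : 0 ≤ A) (hU : ∀ z : Phase d, weight s (U z) ≤ A * weight s z)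
    (hb : ∀ w z, ‖sesq (K z) (phaseShift w φ)‖ ≤ H (w - U z))
    {n : ℝ} (hn : 0 < n) {f u : 𝓢'(Space d, ℂ)}
    (hu : ∀ ψ, n * u ψ = ∫ z, phaseSTFT φ f z * K z ψ) (w : Phase d) :
    ‖weightedSTFT φ (weight s) u w‖ₑ ≤
      ∫⁻ z, ENNReal.ofReal (n⁻¹ * 2 ^ (s / 2) * A * (H (w - U z) * weight s (w - U z))) *
        ‖weightedSTFT φ (weight s) f z‖ₑ := by
  have hn' : (n : ℂ) ≠ 0 := by exact_mod_cast hn.ne'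
  have e : weightedSTFT φ (weight s) u w =
      ∫ z, (n : ℂ)⁻¹ * weight s w * (phaseSTFT φ f z * sesq (K z) (phaseShift w φ)) := by
    rw [integral_const_mul]
    have := hu (conjS (phaseShift w φ))
    change u (conjS (phaseShift w φ)) * _ = (n : ℂ)⁻¹ * weight s w *
      ∫ z, phaseSTFT φ f z * K z (conjS (phaseShift w φ))
    rw [← this]
    field_simp
  rw [e]
  refine (enorm_integral_le_lintegral_enorm _).trans (lintegral_mono fun z => ?_)
  rw [← ofReal_norm, ← ofReal_norm, ← ENNReal.ofReal_mul (by
    have := hH0 (w - U z)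
    have := weight_pos s (w - U z)
    positivity)]
  refine ENNReal.ofReal_le_ofReal ?_
  rw [weightedSTFT_eq]
  simp only [norm_mul, norm_inv, Complex.norm_real, Real.norm_of_nonneg (weight_pos s _).le,
    Real.norm_of_nonneg hn.le]
  -- Writing w = (w - Uz) + Uz splits the weight between the kernel and the STFT of f.
  have h1 : weight s w ≤ 2 ^ (s / 2) * (weight s (w - U z) * (A * weight s z)) := by
    have := weight_add_le hs (w - U z) (U z)
    rw [sub_add_cancel] at this
    refine this.trans ?_
    have := (weight_pos s (w - U z)).le
    gcongr
    exact hU z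
  have h2 := hb w z
  have h3 := hH0 (w - U z)
  have h4 := (weight_pos s (w - U z)).le
  have h5 := (weight_pos s z).le
  calc n⁻¹ * weight s w * (‖phaseSTFT φ f z‖ * ‖sesq (K z) (phaseShift w φ)‖)
      ≤ n⁻¹ * (2 ^ (s / 2) * (weight s (w - U z) * (A * weight s z))) *
        (‖phaseSTFT φ f z‖ * H (w - U z)) := by gcongr
    _ = _ := by ring

/-- Since w - Uz = U(U⁻¹w - z), translation and reflection invariance suffice, and no determinant
appears. -/
theorem lintegral_comp_sub_linearEquiv (U : Phase d ≃L[ℝ] Phase d) (h : Phase d → ℝ≥0∞)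
    (w : Phase d) : ∫⁻ z, h (w - U z) = ∫⁻ z, h (U z) := by
  have := lintegral_sub_left_eq_self (μ := (volume : Measure (Phase d))) (fun z => h (U z))
    (U.symm w)
  simpa using this

/-- `L^p` bound for the STFT of a superposition. -/
theorem exists_modulationNorm_le_of_kernel {φ : 𝓢(Space d, ℂ)} {s : ℝ} (hs : 0 ≤ s)
    {K : Phase d → 𝓢'(Space d, ℂ)} {U : Phase d ≃L[ℝ] Phase d} {H : Phase d → ℝ}
    (hH0 : ∀ z, 0 ≤ H z) (hHm : Measurable H) (hHi : Integrable fun z => H z * weight s z)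
    (hb : ∀ w z, ‖sesq (K z) (phaseShift w φ)‖ ≤ H (w - U z))
    {n : ℝ} (hn : 0 < n) {p : ℝ≥0∞} (hp : 1 ≤ p) :
    ∃ C : ℝ≥0, ∀ f u : 𝓢'(Space d, ℂ), (∀ ψ, n * u ψ = ∫ z, phaseSTFT φ f z * K z ψ) →
      modulationNorm φ p (weight s) u ≤ C * modulationNorm φ p (weight s) f := by
  obtain ⟨A, hA, hU⟩ := exists_weight_le_comp_linearEquiv hs U.symm
  have hU' : ∀ z : Phase d, weight s (U z) ≤ A * weight s z := fun z => by simpa using hU (U z)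
  set h : Phase d → ℝ := fun z => n⁻¹ * 2 ^ (s / 2) * A * (H z * weight s z) with hdef
  have hm : Measurable h := (hHm.mul (continuous_weight s).measurable).const_mul _
  have hi : Integrable h := hHi.const_mul _
  have hiU : Integrable fun z => h (U z) := integrable_comp_linearEquiv hi U
  -- Integrating the kernel in w gives the first term and integrating it in z gives the second.
  -- Their sum serves both Schur conditions.
  set M : ℝ≥0∞ := (∫⁻ z, ENNReal.ofReal (h z)) + ∫⁻ z, ENNReal.ofReal (h (U z))
  have hM : M ≠ ⊤ := ENNReal.add_ne_top.2 ⟨hi.lintegral_lt_top.ne, hiU.lintegral_lt_top.ne⟩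
  refine ⟨M.toNNReal, fun f u hu => ?_⟩
  rw [ENNReal.coe_toNNReal hM]
  have hF : Continuous (weightedSTFT φ (weight s) f) :=
    (continuous_phaseSTFT φ f).mul (Complex.continuous_ofReal.comp (continuous_weight s))
  refine eLpNorm_le_of_schur (k := fun w z => ENNReal.ofReal (h (w - U z))) ?_ hM
    (fun w => ?_) (fun z => ?_) hF.measurable
    (enorm_weightedSTFT_le_of_kernel hs hH0 hA hU' hb hn hu) hp
  · exact ENNReal.measurable_ofReal.comp (hm.comp
      (measurable_fst.sub (U.continuous.measurable.comp measurable_snd)))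
  · rw [lintegral_comp_sub_linearEquiv U fun z => ENNReal.ofReal (h z)]
    exact le_add_self
  · rw [lintegral_sub_right_eq_self fun z => ENNReal.ofReal (h z)]
    exact le_self_add

end Boundedness

/-! ### The extension to modulation spaces, and part (ii). -/

section Extension
variable {d : ℕ}

/-- An operator with weakly continuous orbits whose Gabor matrix is controlled along the graph of a
linear isomorphism is bounded on the modulation spaces. -/
theorem isBoundedOnModulationSpace_of_kernel {φ : 𝓢(Space d, ℂ)} (hφ : φ ≠ 0) {p : ℝ≥0∞}
    (hp : 1 ≤ p) {s : ℝ} (hs : 0 ≤ s) {T : 𝓢(Space d, ℂ) →ₗ[ℂ] 𝓢'(Space d, ℂ)}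
    (hT : ∀ ψ, ∃ L : 𝓢(Space d, ℂ) →L[ℝ] ℂ, ∀ f, L f = T f ψ)
    {U : Phase d ≃L[ℝ] Phase d} {H G : Phase d → ℝ}
    (hH0 : ∀ z, 0 ≤ H z) (hHm : Measurable H) (hHi : Integrable fun z => H z * weight s z)
    (hb : ∀ w z, ‖sesq (T (phaseShift z φ)) (phaseShift w φ)‖ ≤ H (w - U z))
    (hG0 : ∀ z, 0 ≤ G z) (hG : Integrable G) {S : Finset (ℕ × ℕ)} {C : ℝ} (hC : 0 ≤ C)
    (hbG : ∀ (ψ : 𝓢(Space d, ℂ)) (z : Phase d),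
      ‖T (phaseShift z φ) ψ‖ ≤ C * S.sup (schwartzSeminormFamily ℝ (Space d) ℂ) ψ * G z) :
    IsBoundedOnModulationSpace φ p (weight s) T := by
  have hn := normSq_pos hφ
  have hn' : (normSq φ : ℂ) ≠ 0 := by exact_mod_cast hn.ne'
  have hK : ∀ ψ, Continuous fun z : Phase d => T (phaseShift z φ) ψ := fun ψ => by
    obtain ⟨L, hL⟩ := hT ψ
    simp only [← hL]
    exact L.continuous.comp (Continuous.comp (g := fun z : Space d × Space d => tfShift z.1 z.2 φ)
      (continuous_tfShift φ) continuous_pos_freq)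
  obtain ⟨B, hB, hV⟩ := exists_enorm_phaseSTFT_le hφ hp hs
  have hfin : ∀ f : modulationSpace φ p (weight s), modulationNorm φ p (weight s) f ≠ ⊤ :=
    fun f => f.2.2.ne
  -- The extension is T applied under the inversion integral of f: the bounded factor V_φ f is
  -- integrated against the integrable majorant G. This identity determines u, hence the linearity
  -- of the extension.
  have hex : ∀ f : modulationSpace φ p (weight s), ∃ u : 𝓢'(Space d, ℂ), ∀ ψ,
      Integrable (fun z => phaseSTFT φ f z * T (phaseShift z φ) ψ) ∧
      normSq φ * u ψ = ∫ z, phaseSTFT φ f z * T (phaseShift z φ) ψ := fun f => by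
    obtain ⟨u, hu⟩ := exists_superposition (K := fun z => T (phaseShift z φ)) hK hG hC hG0 hbG
      (continuous_phaseSTFT φ f) (norm_phaseSTFT_le_toReal hB (hV f) (hfin f) le_rfl)
    refine ⟨(normSq φ : ℂ)⁻¹ • u, fun ψ => ⟨(hu ψ).1, ?_⟩⟩
    rw [← (hu ψ).2]
    change (normSq φ : ℂ) * ((normSq φ : ℂ)⁻¹ * u ψ) = u ψ
    field_simp
  choose R hRi hR using hex
  obtain ⟨N, hN⟩ := exists_modulationNorm_le_of_kernel (φ := φ) hs
    (K := fun z => T (phaseShift z φ)) hH0 hHm hHi hb hn hp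
  have hext : ∀ u v : 𝓢'(Space d, ℂ), (∀ ψ, normSq φ * u ψ = normSq φ * v ψ) → u = v :=
    fun u v h => by ext ψ; exact mul_left_cancel₀ hn' (h ψ)
  have hmem : ∀ f : modulationSpace φ p (weight s), R f ∈ modulationSpace φ p (weight s) :=
    fun f => by
      change MemLp (weightedSTFT φ (weight s) (R f)) p volume
      refine ⟨((continuous_phaseSTFT φ (R f)).mul
        (Complex.continuous_ofReal.comp (continuous_weight s))).aestronglyMeasurable, ?_⟩
      exact (hN f (R f) (hR f)).trans_lt (ENNReal.mul_lt_top ENNReal.coe_lt_top f.2.2)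
  refine ⟨{ toFun := fun f => ⟨R f, hmem f⟩, map_add' := fun f g => ?_, map_smul' := fun c f => ?_ },
    fun f => ⟨toTemperedDistribution_mem_modulationSpace φ f p s, ?_⟩,
    ⟨N, fun f => hN f (R f) (hR f)⟩, fun u f hu hlim ψ => ?_⟩
  · refine Subtype.ext (hext _ _ fun ψ => ?_)
    change normSq φ * R (f + g) ψ = normSq φ * (R f ψ + R g ψ)
    rw [mul_add, hR, hR, hR, ← integral_add (hRi f ψ) (hRi g ψ)]
    exact integral_congr_ae (Filter.Eventually.of_forall fun z => add_mul _ _ _)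
  · refine Subtype.ext (hext _ _ fun ψ => ?_)
    change normSq φ * R (c • f) ψ = normSq φ * (c * R f ψ)
    rw [mul_left_comm, hR, hR, ← integral_const_mul]
    exact integral_congr_ae (Filter.Eventually.of_forall fun z => mul_assoc _ _ _)
  · refine hext _ _ fun ψ => (hR _ ψ).trans ?_
    obtain ⟨L, hL⟩ := hT ψ
    -- Agreement with T on Schwartz functions is the inversion formula under the continuous
    -- functional f ↦ T f ψ.
    rw [← hL, ← integral_phaseSTFTS_smul φ f L]
    refine integral_congr_ae (Filter.Eventually.of_forall fun z => ?_)
    simp only [hL, map_smul]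
    rw [phaseSTFT_toTemperedDistribution]
    rfl
  · obtain ⟨D, hD⟩ := hu
    have h1 : Filter.Tendsto (fun n => ∫ z, phaseSTFT φ (u n) z * T (phaseShift z φ) ψ)
        Filter.atTop (nhds (∫ z, phaseSTFT φ f z * T (phaseShift z φ) ψ)) := by
      -- Weak convergence gives pointwise convergence of the STFTs. The norm bound D bounds them
      -- uniformly through the embedding into M^∞, and G supplies integrability.
      refine tendsto_integral_of_dominated_convergence
        (fun z => (B * D).toReal *
          (C * S.sup (schwartzSeminormFamily ℝ (Space d) ℂ) ψ * G z))
        (fun n => (hRi (u n) ψ).aestronglyMeasurable) ((hG.const_mul _).const_mul _)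
        (fun n => Filter.Eventually.of_forall fun z => ?_)
        (Filter.Eventually.of_forall fun z => ?_)
      · rw [norm_mul]
        exact mul_le_mul (norm_phaseSTFT_le_toReal hB (hV (u n)) ENNReal.coe_ne_top (hD n) z)
          (hbG ψ z) (norm_nonneg _) ENNReal.toReal_nonneg
      · exact (hlim (conjS (phaseShift z φ))).mul_const _
    simp only [← hR] at h1
    have h2 := h1.const_mul (normSq φ : ℂ)⁻¹
    simp only [inv_mul_cancel_left₀ hn'] at h2
    exact h2

theorem opTau_isBoundedOnModulationSpace {τ : ℝ} (hτ0 : 0 < τ) (hτ1 : τ < 1) {s : ℝ} (hs : 0 ≤ s)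
    {Φ : 𝓢(Phase d, ℂ)} (hΦ : Φ ≠ 0) {σ : 𝓢'(Phase d, ℂ)}
    (hσ : σ ∈ wienerAmalgam Φ ∞ 1 (fun _ => 1) (weight s)) {φ : 𝓢(Space d, ℂ)} (hφ : φ ≠ 0)
    {p : ℝ≥0∞} (hp : 1 ≤ p) : IsBoundedOnModulationSpace φ p (weight s) (opTau τ σ) := by
  have h1 : 1 - τ ≠ 0 := sub_ne_zero.2 hτ1.ne'
  obtain ⟨H, G, hH0, hHm, hHi, hG0, hGi, hb, hbG⟩ := exists_kernel_bound hτ0.ne' h1 hs hΦ hσ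
  obtain ⟨A, hA, hb⟩ := hb φ φ
  obtain ⟨S, C, hC, hbG⟩ := hbG φ
  -- U_τ acts as a dilation with nonzero factors -τ/(1-τ) and -(1-τ)/τ, hence as a linear
  -- isomorphism.
  have hU : ∀ z : Phase d, Matrix.toEuclideanCLM (𝕜 := ℝ) (tauMatrix d τ) z =
      phaseScale (neg_ne_zero.2 (div_ne_zero hτ0.ne' h1)) (neg_ne_zero.2 (div_ne_zero h1 hτ0.ne'))
        z := fun z => phase_ext
    (by rw [pos_tauMatrix, pos_phaseScale, neg_smul])
    (by rw [freq_tauMatrix, freq_phaseScale, neg_smul])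
  simp only [hU] at hb
  refine isBoundedOnModulationSpace_of_kernel hφ hp hs
    (fun ψ => ⟨opTauFunctional τ σ ψ, fun f => opTauFunctional_apply τ σ ψ f⟩)
    (H := fun z => A * H z) (fun z => mul_nonneg hA (hH0 z)) (hHm.const_mul A) ?_ hb hG0 hGi hC hbG
  simpa only [mul_assoc] using hHi.const_mul A

end Extension
end TimeFrequency
end

theorem mainTheorem9 (d : ℕ) (τ : ℝ) (hτ0 : 0 < τ) (hτ1 : τ < 1) (s : ℝ) (hs : 0 ≤ s)
    (Φ : 𝓢(Phase d, ℂ)) (hΦ : Φ ≠ 0) (σ : 𝓢'(Phase d, ℂ))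
    (hσ : σ ∈ wienerAmalgam Φ ∞ 1 (fun _ => 1) (weight s)) :
    (∀ g : 𝓢(Space d, ℂ), opTau τ σ ∈
      generalizedMetaplectic g ⟨tauMatrix d τ, tauMatrix_mem hτ0.ne' hτ1.ne⟩ s) ∧
    (∀ (φ : 𝓢(Space d, ℂ)) (p : ℝ≥0∞), φ ≠ 0 → 1 ≤ p →
      IsBoundedOnModulationSpace φ p (weight s) (opTau τ σ)) :=
  ⟨opTau_mem_generalizedMetaplectic hτ0 hτ1 hs hΦ hσ,
    fun _ _ hφ hp => opTau_isBoundedOnModulationSpace hτ0 hτ1 hs hΦ hσ hφ hp⟩
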